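/- For $r\in(1,\infty)$ let $r':=r/(r-1)$ denote the Hölder conjugate. Let $(\Omega,\mathcal A,\mathbb P)$ be a probability space and $(S,\mathcal S,\mu)$ a $\sigma$-finite measure space with the *approximation-by-averaging property*: for every $n\in\mathbb N$ there is a finite or countable family $\{B^n_k\}_{k\in K_n}$ of pairwise disjoint measurable sets with $\mu(B_k^n)\in(0,\infty)$, such that for every Banach space $E$, every $p\in[1,\infty)$ and every $f\in L^p(S;E)$ the functions $f_n:=\sum_{k\in K_n}\mathbf 1_{B_k^n}\,\mu(B_k^n)^{-1}\int_{B_k^n}f\,\mathrm d\mu$ converge to $f$ in $L^p(S;E)$. Let $q\in(1,2)$, $p\in[1,q]$, $\widetilde q\in[q,\infty)$, $\widehat q:=\min\{\widetilde q,2\}$, and $X\in L^1(\Omega;L^p(S))$. For $\ell\in\mathbb N=\{1,2,\dots\}$ let $X_\ell\in L^{\widetilde q}(\Omega;L^p(S))\cap L^p(S;L^{\widetilde q}(\Omega))$, where membership of an $L^p(S)$-valued random variable in $L^p(S;L^{r}(\Omega))$, and its norm there, are understood through a jointly measurable version on $S\times\Omega$. Set $X_0:=0$, $\xi_\ell:=X_\ell-X_{\ell-1}$,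 and for each $\ell\in\mathbb N$ let $(\xi_{\ell,j})_{j\in\mathbb N}\subset L^{\widetilde q}(\Omega;L^p(S))\cap L^p(S;L^{\widetilde q}(\Omega))$ be a sequence of independent copies of $\xi_\ell$. Let $\mathcal C_\ell$ be the cost of generating one sample of $\xi_\ell$. Suppose that there are constants $\alpha,\gamma,C_\alpha,C_\beta,C_\gamma,b_1,c_1,c_2\in(0,\infty)$, $b_0\in\mathbb R$, $A\in(1,\infty)$, and numbers $N_\ell$ with $c_1A^\ell\le N_\ell\le c_2A^\ell$, such that $\beta(r):=b_0+\frac{b_1}{r}>0$ for all $r\in[q,\widehat q]$ and, for all $\ell\in\mathbb N$ and all $r\in[q,\widehat q]$, \[ \|\mathbb E[X]-\mathbb E[X_\ell]\|_{L^p(S)}\le C_\alpha N_\ell^{-\alpha},\qquad \|X_\ell-\mathbb E[X_\ell]-(X_{\ell-1}-\mathbb E[X_{\ell-1}])\|_{L^p(S;L^r(\Omega))}\le C_\beta N_\ell^{-\beta(r)},\qquad \mathcal C_\ell\le C_\gamma N_\ell^{\gamma}. \] Put $t:=\frac{\gamma+b_1}{b_0+b_1}$ and, for $\epsilon\in(0,\frac12]$,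 \[ \Phi(\epsilon):=\epsilon^{-\frac{\gamma}{\alpha}}+ \begin{cases} \epsilon^{-\widehat q'} & \text{if } t<\widehat q',\\ \epsilon^{-\widehat q'}|\log_A\epsilon|^{\widehat q'+1} & \text{if } t=\widehat q',\\ \epsilon^{-\widehat q'-\frac{\gamma+b_1-(b_0+b_1)\widehat q'}{\alpha}} & \text{if } t\in(\widehat q',q'] \text{ and } \alpha\ge b_0+b_1,\\ \epsilon^{-t}|\log_A\epsilon|^{t+1} & \text{if } t\in(\widehat q',q'] \text{ and } \alpha<b_0+b_1,\\ \epsilon^{-\widehat q'-\frac{\gamma+b_1-(b_0+b_1)\widehat q'}{\alpha}} & \text{if } t>q' \text{ and } \alpha\ge b_0+b_1,\\ \epsilon^{-q'-\frac{\gamma+b_1-(b_0+b_1)q'}{\alpha}} & \text{if } t>q' \text{ and } \alpha<b_0+b_1. \end{cases} \] Then there is a constant $C\in(0,\infty)$, depending only on $q,\widetilde q,\alpha,\gamma,b_0,b_1,A,C_\alpha,C_\beta,C_\gamma,c_1,c_2$, such that for every $\epsilon\in(0,\frac12]$ there exist integers $L\in\mathbb N$ and $M_1,\dots,M_L\in\mathbb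 N$ for which the multilevel Monte Carlo estimator for $\mathbb E[X]$ satisfies \[ \biggl\|\mathbb E[X]-\sum_{\ell=1}^L\frac1{M_\ell}\sum_{j=1}^{M_\ell}\xi_{\ell,j}\biggr\|_{L^q(\Omega;L^p(S))}<\epsilon \qquad\text{at a cost}\qquad \sum_{\ell=1}^L M_\ell\,\mathcal C_\ell\le C\,\Phi(\epsilon). \] Moreover, this cost bound is optimal among the bounds obtained from a fixed exponent $r\in[q,\widehat q]$: with \[ \Phi_r(\epsilon):=\epsilon^{-\frac{\gamma}{\alpha}}+ \begin{cases} \epsilon^{-r'} & \text{if } \beta(r)>\frac{\gamma}{r'},\\ \epsilon^{-r'}|\log_A\epsilon|^{r'+1} & \text{if } \beta(r)=\frac{\gamma}{r'},\\ \epsilon^{-r'-\frac{\gamma-\beta(r)r'}{\alpha}} & \text{if } \beta(r)<\frac{\gamma}{r'}, \end{cases} \] there is $r\in[q,\widehat q]$ with $\Phi=\Phi_r$ on $(0,\frac12]$, and for every $r\in[q,\widehat q]$ there is $C_r\in(0,\infty)$ with $\Phi\le C_r\Phi_r$ on $(0,\frac12]$. -/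

import Mathlib

open MeasureTheory ProbabilityTheory Filter Topology
open scoped ENNReal

universe u v w

noncomputable section

namespace MLMC

/-- The function `f_n = ∑_{k ∈ K} 1_{B_k} (1/μ(B_k)) ∫_{B_k} f dμ` obtained by averaging `f` over the
sets `B k`, `k ∈ K`. For pairwise disjoint sets at most one term is nonzero at every point. -/
def blockAverage {S : Type u} [MeasurableSpace S] (μ : Measure S) {E : Type w}
    [NormedAddCommGroup E] [NormedSpace ℝ E] (K : Set ℕ) (B : ℕ → Set S) (f : S → E) : S → E :=
  fun s => ∑' k : K, (B k).indicator (fun _ => ⨍ x in B k, f x ∂μ) s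

/-- The approximation-by-averaging property of a measure space. The countable families of sets
(indexed by subsets `K n` of `ℕ`) do not depend on the Banach space, on the exponent or on the
function. -/
def ApproximationByAveraging {S : Type u} [MeasurableSpace S] (μ : Measure S) : Prop :=
  ∃ (K : ℕ → Set ℕ) (B : ℕ → ℕ → Set S),
    (∀ n, ∀ k ∈ K n, MeasurableSet (B n k) ∧ 0 < μ (B n k) ∧ μ (B n k) < ∞) ∧
    (∀ n, (K n).PairwiseDisjoint (B n)) ∧
    ∀ (E : Type w) [NormedAddCommGroup E] [NormedSpace ℝ E] [CompleteSpace E]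
      (p : ℝ≥0∞), 1 ≤ p → p ≠ ∞ → ∀ f : S → E, MemLp f p μ →
        Tendsto (fun n => eLpNorm (f - blockAverage μ (K n) (B n) f) p μ) atTop (𝓝 0)

section Mixed

variable {S : Type u} [MeasurableSpace S] {Ω : Type v} [MeasurableSpace Ω]
  {μ : Measure S} {p : ℝ≥0∞}

/-- `L^p(S)` carries its Borel σ-algebra. -/
instance lpMeasurableSpace [Fact (1 ≤ p)] : MeasurableSpace (Lp ℝ p μ) := borel _

instance lpBorelSpace [Fact (1 ≤ p)] : BorelSpace (Lp ℝ p μ) := ⟨rfl⟩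

/-- `f` is a jointly measurable version of the `L^p(S)`-valued random variable `η`. -/
def IsVersion (P : Measure Ω) (η : Ω → Lp ℝ p μ) (f : S × Ω → ℝ) : Prop :=
  Measurable f ∧ ∀ᵐ ω ∂P, (η ω : S → ℝ) =ᵐ[μ] fun s => f (s, ω)

/-- `η ∈ L^p(S; L^q(Ω))`: for a jointly measurable version `f` of `η`, the map `s ↦ f(s, ·)` is
an element of the Bochner space `L^p(S; L^q(Ω))`. -/
def MemLpLq (P : Measure Ω) (q : ℝ≥0∞) [Fact (1 ≤ q)] (η : Ω → Lp ℝ p μ) : Prop :=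
  ∃ (f : S × Ω → ℝ) (g : S → Lp ℝ q P), IsVersion P η f ∧
    (∀ᵐ s ∂μ, (g s : Ω → ℝ) =ᵐ[P] fun ω => f (s, ω)) ∧ MemLp g p μ

/-- The norm of `η` in `L^p(S; L^r(Ω))`, computed from a jointly measurable version of `η`.
Versions agree almost everywhere on the product, so for σ-finite `μ` all of them give the
same value, and the infimum only selects it (it is `∞` if there is no version). -/
def mixedNorm (P : Measure Ω) (r : ℝ≥0∞) (η : Ω → Lp ℝ p μ) : ℝ≥0∞ :=
  ⨅ (f : S × Ω → ℝ) (_ : IsVersion P η f),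
    eLpNorm (fun s => eLpNorm (fun ω => f (s, ω)) r P) p μ

variable [Fact (1 ≤ p)]

/-- The level increment `ξ_ℓ = X_ℓ - X_{ℓ-1}`, used for `ℓ ≥ 1`. -/
def increment (X : ℕ → Ω → Lp ℝ p μ) (ℓ : ℕ) (ω : Ω) : Lp ℝ p μ :=
  X ℓ ω - X (ℓ - 1) ω

/-- The multilevel Monte Carlo estimator `∑_{ℓ=1}^L (1/M_ℓ) ∑_j ξ_{ℓ,j}`, with `M_ℓ` samples on
level `ℓ` (numbered from `0`). -/
def estimator (ξ : ℕ → ℕ → Ω → Lp ℝ p μ) (L : ℕ) (M : ℕ → ℕ) (ω : Ω) : Lp ℝ p μ :=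
  ∑ ℓ ∈ Finset.Icc 1 L, (M ℓ : ℝ)⁻¹ • ∑ j ∈ Finset.range (M ℓ), ξ ℓ j ω

/-- The `L^q`-accuracy of the estimator for `E[X]`, in the norm of `L^q(Ω; L^p(S))`. -/
def mlmcError (P : Measure Ω) (q : ℝ) (X : Ω → Lp ℝ p μ) (ξ : ℕ → ℕ → Ω → Lp ℝ p μ)
    (L : ℕ) (M : ℕ → ℕ) : ℝ≥0∞ :=
  eLpNorm (fun ω => (∫ ω', X ω' ∂P) - estimator ξ L M ω) (ENNReal.ofReal q) P

/-- The assumptions on the random variables, their samples and the cost per sample.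
`Xlim` is the random variable whose mean is estimated, `X ℓ` its approximation on level `ℓ ≥ 1`
(with `X 0 = 0`), `ξ ℓ j` are the samples of the increment on level `ℓ`, and `cost ℓ` is the cost
of one such sample. -/
structure Setting (μ : Measure S) (P : Measure Ω) (q qt α γ : ℝ) [Fact (1 ≤ ENNReal.ofReal qt)]
    (β : ℝ → ℝ) (A Cα Cβ Cγ c₁ c₂ : ℝ)
    (Xlim : Ω → Lp ℝ p μ) (X : ℕ → Ω → Lp ℝ p μ) (ξ : ℕ → ℕ → Ω → Lp ℝ p μ)
    (N cost : ℕ → ℝ) : Prop where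
  integrable_lim : MemLp Xlim 1 P
  zero_level : ∀ ω, X 0 ω = 0
  memLp_level : ∀ ℓ, 1 ≤ ℓ → MemLp (X ℓ) (ENNReal.ofReal qt) P
  memLpLq_level : ∀ ℓ, 1 ≤ ℓ → MemLpLq P (ENNReal.ofReal qt) (X ℓ)
  N_equiv : ∀ ℓ, 1 ≤ ℓ → c₁ * A ^ ℓ ≤ N ℓ ∧ N ℓ ≤ c₂ * A ^ ℓ
  bias : ∀ ℓ, 1 ≤ ℓ → ‖(∫ ω, Xlim ω ∂P) - ∫ ω, X ℓ ω ∂P‖ ≤ Cα * N ℓ ^ (-α)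
  strong : ∀ r ∈ Set.Icc q (min qt 2), ∀ ℓ, 1 ≤ ℓ →
    mixedNorm P (ENNReal.ofReal r)
      (fun ω => X ℓ ω - (∫ ω', X ℓ ω' ∂P) - (X (ℓ - 1) ω - ∫ ω', X (ℓ - 1) ω' ∂P))
      ≤ ENNReal.ofReal (Cβ * N ℓ ^ (-β r))
  cost_le : ∀ ℓ, 1 ≤ ℓ → cost ℓ ≤ Cγ * N ℓ ^ γ
  memLp_sample : ∀ ℓ, 1 ≤ ℓ → ∀ j, MemLp (ξ ℓ j) (ENNReal.ofReal qt) P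
  memLpLq_sample : ∀ ℓ, 1 ≤ ℓ → ∀ j, MemLpLq P (ENNReal.ofReal qt) (ξ ℓ j)
  indep : ∀ ℓ, 1 ≤ ℓ → iIndepFun (ξ ℓ) P
  copy : ∀ ℓ, 1 ≤ ℓ → ∀ j, IdentDistrib (ξ ℓ j) (increment X ℓ) P P

end Mixed

/-- The cost of the estimator: `M_ℓ` samples of cost `cost ℓ` on each level `ℓ = 1, …, L`. -/
def mlmcCost (cost : ℕ → ℝ) (L : ℕ) (M : ℕ → ℕ) : ℝ :=
  ∑ ℓ ∈ Finset.Icc 1 L, (M ℓ : ℝ) * cost ℓ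

/-- The cost bound belonging to a fixed exponent `r`, with `r' = r / (r - 1)`. -/
def costBound (α γ : ℝ) (β : ℝ → ℝ) (A r ε : ℝ) : ℝ :=
  let r' := Real.conjExponent r
  if γ / r' < β r then ε ^ (-(γ / α)) + ε ^ (-r')
  else if β r = γ / r' then ε ^ (-(γ / α)) + ε ^ (-r') * |Real.logb A ε| ^ (r' + 1)
  else ε ^ (-(γ / α)) + ε ^ (-r' - (γ - β r * r') / α)

/-- The optimized cost bound for `β(r) = b₀ + b₁ / r`; `qh` stands for `min q̃ 2`. -/
def optimalCostBound (q qh α γ b₀ b₁ A ε : ℝ) : ℝ :=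
  let q' := Real.conjExponent q
  let qh' := Real.conjExponent qh
  let t := (γ + b₁) / (b₀ + b₁)
  if t < qh' then ε ^ (-(γ / α)) + ε ^ (-qh')
  else if t = qh' then ε ^ (-(γ / α)) + ε ^ (-qh') * |Real.logb A ε| ^ (qh' + 1)
  else if t ≤ q' then
    if b₀ + b₁ ≤ α then
      ε ^ (-(γ / α)) + ε ^ (-qh' - (γ + b₁ - (b₀ + b₁) * qh') / α)
    else ε ^ (-(γ / α)) + ε ^ (-t) * |Real.logb A ε| ^ (t + 1)
  else
    if b₀ + b₁ ≤ α then
      ε ^ (-(γ / α)) + ε ^ (-qh' - (γ + b₁ - (b₀ + b₁) * qh') / α)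
    else ε ^ (-(γ / α)) + ε ^ (-q' - (γ + b₁ - (b₀ + b₁) * q') / α)

end MLMC

end

/-!
Applied for almost every fixed `s ∈ S`, the von Bahr–Esseen inequality bounds the `L^r(Ω)`-norm of
a sum of `m` independent centred copies of `ζ(s)` by a constant times `m^(1/r) ‖ζ(s)‖_{L^r(Ω)}`.
Since `p ≤ q`, Minkowski's integral inequality embeds `L^p(S; L^q(Ω))` into `L^q(Ω; L^p(S))`, so
one level with `M` samples contributes at most a multiple of `M^(1/r - 1) ‖ζ‖_{L^p(S; L^r(Ω))}` to
the error. No geometry of `L^p(S)` enters, which is why exponents `r > p` can be used.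

With `κ = γ - β(r) r'`, splitting the error budget over the levels in proportion to
`A^(κ ℓ / (2 r'))` makes the sampling cost `ε^(-r')` times a product of two geometric sums whose
exponents have the sign of `κ`; this is the source of the three regimes. As `β(r) = b₀ + b₁ / r`,
both `r'` and `r' + κ / α` are affine in `x = r'`, namely `x` and
`x + (γ + b₁ - (b₀ + b₁) x) / α`. Optimizing the exponent means minimizing their maximum over an
interval of `x`: the first increases, the second is monotone with a direction determined by
comparing `α` with `b₀ + b₁`, and they cross at `x = t`.
-/

namespace MLMC

/-- The odd power function `x ↦ sign x · |x| ^ s`: up to the factor `r`, the derivative of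
`|x| ^ r` is `signedRpow (r - 1) x`. -/
noncomputable def signedRpow (s x : ℝ) : ℝ :=
  |x| ^ (s - 1) * x

theorem signedRpow_of_nonneg {s x : ℝ} (hs : s ≠ 0) (hx : 0 ≤ x) : signedRpow s x = x ^ s := by
  rcases hx.eq_or_lt with rfl | hx
  · simp [signedRpow, Real.zero_rpow hs]
  · rw [signedRpow, abs_of_pos hx, ← Real.rpow_add_one hx.ne', sub_add_cancel]

theorem signedRpow_neg (s x : ℝ) : signedRpow s (-x) = -signedRpow s x := by
  simp only [signedRpow, abs_neg, mul_neg]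

theorem signedRpow_of_nonpos {s x : ℝ} (hs : s ≠ 0) (hx : x ≤ 0) :
    signedRpow s x = -(-x) ^ s := by
  rw [← signedRpow_of_nonneg hs (neg_nonneg.2 hx), signedRpow_neg, neg_neg]

theorem abs_signedRpow {s : ℝ} (hs : s ≠ 0) (x : ℝ) : |signedRpow s x| = |x| ^ s := by
  rw [← signedRpow_of_nonneg hs (abs_nonneg x), signedRpow, signedRpow, abs_mul, abs_abs,
    abs_of_nonneg (Real.rpow_nonneg (abs_nonneg x) _)]

theorem measurable_signedRpow (s : ℝ) : Measurable (signedRpow s) := by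
  unfold signedRpow
  fun_prop

theorem hasDerivAt_abs_rpow_signedRpow {r : ℝ} (hr : 1 < r) (x : ℝ) :
    HasDerivAt (fun x : ℝ => |x| ^ r) (r * signedRpow (r - 1) x) x := by
  have h := hasDerivAt_abs_rpow x hr
  rwa [mul_assoc, show r - 2 = r - 1 - 1 by ring] at h

theorem rpow_sub_rpow_le_rpow_sub {s x y : ℝ} (hs : 0 ≤ s) (hs1 : s ≤ 1) (hy : 0 ≤ y)
    (hyx : y ≤ x) : x ^ s - y ^ s ≤ (x - y) ^ s := by
  have h := Real.rpow_add_le_add_rpow hy (sub_nonneg.2 hyx) hs hs1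
  rw [add_sub_cancel] at h
  linarith

theorem abs_signedRpow_sub_le_of_nonneg {s : ℝ} (hs : 0 < s) (hs1 : s ≤ 1) {x y : ℝ} (hy : 0 ≤ y)
    (hyx : y ≤ x) : |signedRpow s x - signedRpow s y| ≤ 2 * |x - y| ^ s := by
  have hpow : 0 ≤ (x - y) ^ s := Real.rpow_nonneg (sub_nonneg.2 hyx) s
  rw [signedRpow_of_nonneg hs.ne' hy, signedRpow_of_nonneg hs.ne' (hy.trans hyx),
    abs_of_nonneg (sub_nonneg.2 hyx),
    abs_of_nonneg (sub_nonneg.2 (Real.rpow_le_rpow hy hyx hs.le))]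
  linarith [rpow_sub_rpow_le_rpow_sub hs.le hs1 hy hyx]

theorem abs_signedRpow_sub_le_of_nonpos_of_nonneg {s : ℝ} (hs : 0 < s) {x y : ℝ} (hy : y ≤ 0)
    (hx : 0 ≤ x) : |signedRpow s x - signedRpow s y| ≤ 2 * |x - y| ^ s := by
  have hx_le : x ^ s ≤ (x - y) ^ s := Real.rpow_le_rpow hx (by linarith) hs.le
  have hy_le : (-y) ^ s ≤ (x - y) ^ s := Real.rpow_le_rpow (by linarith) (by linarith) hs.le
  rw [signedRpow_of_nonneg hs.ne' hx, signedRpow_of_nonpos hs.ne' hy, sub_neg_eq_add,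
    abs_of_nonneg (by linarith : 0 ≤ x - y),
    abs_of_nonneg (add_nonneg (Real.rpow_nonneg hx _) (Real.rpow_nonneg (by linarith) _))]
  linarith

theorem abs_signedRpow_sub_le {s : ℝ} (hs : 0 < s) (hs1 : s ≤ 1) (x y : ℝ) :
    |signedRpow s x - signedRpow s y| ≤ 2 * |x - y| ^ s := by
  wlog hyx : y ≤ x generalizing x y
  · rw [abs_sub_comm, abs_sub_comm x y]
    exact this y x (le_of_not_ge hyx)
  rcases le_total 0 y with hy | hy
  · exact abs_signedRpow_sub_le_of_nonneg hs hs1 hy hyx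
  rcases le_total 0 x with hx | hx
  · exact abs_signedRpow_sub_le_of_nonpos_of_nonneg hs hy hx
  · have h := abs_signedRpow_sub_le_of_nonneg hs hs1 (neg_nonneg.2 hx) (neg_le_neg hyx)
    rwa [signedRpow_neg, signedRpow_neg, neg_sub_neg, neg_sub_neg] at h

theorem signedRpow_sub_mul_le {r θ : ℝ} (hr : 1 < r) (hr2 : r ≤ 2) (hθ : θ ∈ Set.Ioo (0 : ℝ) 1)
    (a b : ℝ) :
    (signedRpow (r - 1) (a + θ * b) - signedRpow (r - 1) a) * b ≤ 2 * |b| ^ r := by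
  have hθb : |a + θ * b - a| ≤ |b| := by
    rw [add_sub_cancel_left, abs_mul, abs_of_pos hθ.1]
    exact mul_le_of_le_one_left (abs_nonneg b) hθ.2.le
  have hholder : |signedRpow (r - 1) (a + θ * b) - signedRpow (r - 1) a| ≤ 2 * |b| ^ (r - 1) :=
    (abs_signedRpow_sub_le (by linarith) (by linarith) _ _).trans
      (mul_le_mul_of_nonneg_left (Real.rpow_le_rpow (abs_nonneg _) hθb (by linarith)) two_pos.le)
  calc (signedRpow (r - 1) (a + θ * b) - signedRpow (r - 1) a) * b
      ≤ |signedRpow (r - 1) (a + θ * b) - signedRpow (r - 1) a| * |b| := by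
        rw [← abs_mul]
        exact le_abs_self _
    _ ≤ 2 * |b| ^ (r - 1) * |b| := mul_le_mul_of_nonneg_right hholder (abs_nonneg b)
    _ = 2 * |b| ^ r := by
        rw [mul_assoc, ← Real.rpow_add_one' (abs_nonneg b) (by linarith), sub_add_cancel]

theorem abs_add_rpow_le {r : ℝ} (hr : 1 < r) (hr2 : r ≤ 2) (a b : ℝ) :
    |a + b| ^ r ≤ |a| ^ r + r * (signedRpow (r - 1) a * b) + 4 * |b| ^ r := by
  have hderiv (t : ℝ) : HasDerivAt (fun t : ℝ => |a + t * b| ^ r)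
      (r * signedRpow (r - 1) (a + t * b) * b) t := by
    have hline : HasDerivAt (fun t : ℝ => a + t * b) b t := by
      simpa using ((hasDerivAt_id t).mul_const b).const_add a
    exact (hasDerivAt_abs_rpow_signedRpow hr (a + t * b)).comp t hline
  obtain ⟨θ, hθ, hslope⟩ := exists_hasDerivAt_eq_slope (fun t : ℝ => |a + t * b| ^ r) _ zero_lt_one
    (fun t _ => (hderiv t).continuousAt.continuousWithinAt) (fun t _ => hderiv t)
  simp only [one_mul, zero_mul, add_zero, sub_zero, div_one] at hslope
  have hincr := signedRpow_sub_mul_le hr hr2 hθ a b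
  have hnonneg : 0 ≤ |b| ^ r := Real.rpow_nonneg (abs_nonneg b) r
  nlinarith

section VonBahrEsseen

variable {Ω : Type*} [MeasurableSpace Ω] {P : Measure Ω} {r : ℝ}

theorem integrable_abs_rpow (hr : 0 < r) {U : Ω → ℝ} (hU : MemLp U (ENNReal.ofReal r) P) :
    Integrable (fun ω => |U ω| ^ r) P := by
  have h := hU.integrable_norm_rpow (ENNReal.ofReal_pos.2 hr).ne' ENNReal.ofReal_ne_top
  rwa [ENNReal.toReal_ofReal hr.le] at h

theorem eLpNorm_eq_ofReal_integral_abs_rpow (hr : 0 < r) {U : Ω → ℝ}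
    (hU : MemLp U (ENNReal.ofReal r) P) :
    eLpNorm U (ENNReal.ofReal r) P = ENNReal.ofReal ((∫ ω, |U ω| ^ r ∂P) ^ r⁻¹) := by
  rw [hU.eLpNorm_eq_integral_rpow_norm (ENNReal.ofReal_pos.2 hr).ne' ENNReal.ofReal_ne_top,
    ENNReal.toReal_ofReal hr.le]
  rfl

theorem rpow_sub_one_mul_le_add (hr : 1 ≤ r) {x y : ℝ} (hx : 0 ≤ x) (hy : 0 ≤ y) :
    x ^ (r - 1) * y ≤ x ^ r + y ^ r := by
  have hmul (z : ℝ) (hz : 0 ≤ z) : z ^ (r - 1) * z = z ^ r := by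
    rw [← Real.rpow_add_one' hz (by linarith), sub_add_cancel]
  rcases le_total x y with hxy | hyx
  · calc x ^ (r - 1) * y ≤ y ^ (r - 1) * y :=
          mul_le_mul_of_nonneg_right (Real.rpow_le_rpow hx hxy (by linarith)) hy
      _ ≤ x ^ r + y ^ r := by
          rw [hmul y hy]
          exact le_add_of_nonneg_left (Real.rpow_nonneg hx r)
  · calc x ^ (r - 1) * y ≤ x ^ (r - 1) * x :=
          mul_le_mul_of_nonneg_left hyx (Real.rpow_nonneg hx _)
      _ ≤ x ^ r + y ^ r := by
          rw [hmul x hx]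
          exact le_add_of_nonneg_right (Real.rpow_nonneg hy r)

theorem integrable_signedRpow_mul (hr : 1 < r) {U V : Ω → ℝ}
    (hU : MemLp U (ENNReal.ofReal r) P) (hV : MemLp V (ENNReal.ofReal r) P) :
    Integrable (fun ω => signedRpow (r - 1) (U ω) * V ω) P := by
  have hr0 : 0 < r := zero_lt_one.trans hr
  have hmeas : AEStronglyMeasurable (fun ω => signedRpow (r - 1) (U ω) * V ω) P :=
    (((measurable_signedRpow _).comp_aemeasurable hU.aestronglyMeasurable.aemeasurable).mul
      hV.aestronglyMeasurable.aemeasurable).aestronglyMeasurable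
  refine ((integrable_abs_rpow hr0 hU).add (integrable_abs_rpow hr0 hV)).mono' hmeas
    (ae_of_all _ fun ω => ?_)
  rw [norm_mul, Real.norm_eq_abs, Real.norm_eq_abs, abs_signedRpow (by linarith)]
  exact rpow_sub_one_mul_le_add hr.le (abs_nonneg _) (abs_nonneg _)

theorem integral_abs_add_rpow_le_of_indepFun (hr : 1 < r) (hr2 : r ≤ 2) {U V : Ω → ℝ}
    (hUV : IndepFun U V P) (hU : MemLp U (ENNReal.ofReal r) P) (hV : MemLp V (ENNReal.ofReal r) P)
    (hV0 : ∫ ω, V ω ∂P = 0) :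
    ∫ ω, |U ω + V ω| ^ r ∂P ≤ (∫ ω, |U ω| ^ r ∂P) + 4 * ∫ ω, |V ω| ^ r ∂P := by
  have hr0 : 0 < r := zero_lt_one.trans hr
  have hU_int := integrable_abs_rpow hr0 hU
  have hV_int := (integrable_abs_rpow hr0 hV).const_mul 4
  have hcross_int := (integrable_signedRpow_mul hr hU hV).const_mul r
  have hUcross_int :
      Integrable (fun ω => |U ω| ^ r + r * (signedRpow (r - 1) (U ω) * V ω)) P :=
    hU_int.add hcross_int
  have hcross : ∫ ω, signedRpow (r - 1) (U ω) * V ω ∂P = 0 := by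
    have h := (hUV.comp (measurable_signedRpow (r - 1))
      measurable_id).integral_fun_mul_eq_mul_integral
        ((measurable_signedRpow _).comp_aemeasurable
          hU.aestronglyMeasurable.aemeasurable).aestronglyMeasurable hV.aestronglyMeasurable
    simpa only [Function.comp_apply, id_eq, hV0, mul_zero] using h
  calc ∫ ω, |U ω + V ω| ^ r ∂P
      ≤ ∫ ω, (|U ω| ^ r + r * (signedRpow (r - 1) (U ω) * V ω) + 4 * |V ω| ^ r) ∂P :=
        integral_mono_of_nonneg (ae_of_all _ fun ω => Real.rpow_nonneg (abs_nonneg _) _)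
          (hUcross_int.add hV_int)
          (ae_of_all _ fun ω => abs_add_rpow_le hr hr2 (U ω) (V ω))
    _ = (∫ ω, |U ω| ^ r ∂P) + 4 * ∫ ω, |V ω| ^ r ∂P := by
        rw [integral_add hUcross_int hV_int, integral_add hU_int hcross_int,
          integral_const_mul, integral_const_mul, hcross, mul_zero, add_zero]

variable {ι : Type*} {Z : ι → Ω → ℝ}

theorem integral_abs_sum_rpow_le_of_iIndepFun (hr : 1 < r) (hr2 : r ≤ 2) (hind : iIndepFun Z P)
    (hZ : ∀ j, MemLp (Z j) (ENNReal.ofReal r) P) (hZ0 : ∀ j, ∫ ω, Z j ω ∂P = 0) (J : Finset ι) :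
    ∫ ω, |∑ j ∈ J, Z j ω| ^ r ∂P ≤ 4 * ∑ j ∈ J, ∫ ω, |Z j ω| ^ r ∂P := by
  classical
  induction J using Finset.induction_on with
  | empty => simp [Real.zero_rpow (by linarith : r ≠ 0)]
  | insert i J hi ih =>
    have hindep : IndepFun (Z i) (fun ω => ∑ j ∈ J, Z j ω) P := by
      simpa only [Finset.sum_fn] using (hind.indepFun_finsetSum_of_notMem₀
        (fun j => (hZ j).aestronglyMeasurable.aemeasurable) hi).symm
    have hadd := integral_abs_add_rpow_le_of_indepFun hr hr2 hindep.symm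
      (memLp_finsetSum J fun j _ => hZ j) (hZ i) (hZ0 i)
    simp only [Finset.sum_insert hi, add_comm (Z i _)]
    linarith

theorem eLpNorm_sum_le_of_iIndepFun (hr : 1 < r) (hr2 : r ≤ 2) (hind : iIndepFun Z P)
    (hmeas : ∀ j, AEStronglyMeasurable (Z j) P) (hZ0 : ∀ j, ∫ ω, Z j ω ∂P = 0) {c : ℝ≥0∞}
    (hc : ∀ j, eLpNorm (Z j) (ENNReal.ofReal r) P ≤ c) {J : Finset ι} (hJ : J.Nonempty) :
    eLpNorm (fun ω => ∑ j ∈ J, Z j ω) (ENNReal.ofReal r) P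
      ≤ ENNReal.ofReal ((4 * J.card) ^ r⁻¹) * c := by
  have hr0 : 0 < r := zero_lt_one.trans hr
  rcases eq_or_ne c ∞ with rfl | hc_top
  · have hcard : (0 : ℝ) < J.card := by exact_mod_cast hJ.card_pos
    rw [ENNReal.mul_top (ENNReal.ofReal_pos.2 (by positivity)).ne']
    exact le_top
  have hmem (j : ι) : MemLp (Z j) (ENNReal.ofReal r) P :=
    ⟨hmeas j, (hc j).trans_lt hc_top.lt_top⟩
  have hnonneg (U : Ω → ℝ) : 0 ≤ ∫ ω, |U ω| ^ r ∂P :=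
    integral_nonneg fun ω => Real.rpow_nonneg (abs_nonneg _) _
  have hmoment (j : ι) : ∫ ω, |Z j ω| ^ r ∂P ≤ c.toReal ^ r := by
    have h := hc j
    rw [eLpNorm_eq_ofReal_integral_abs_rpow hr0 (hmem j),
      ENNReal.ofReal_le_iff_le_toReal hc_top] at h
    exact (Real.rpow_inv_le_iff_of_pos (hnonneg _) ENNReal.toReal_nonneg hr0).1 h
  have hsum : ∫ ω, |∑ j ∈ J, Z j ω| ^ r ∂P ≤ 4 * J.card * c.toReal ^ r := by
    refine (integral_abs_sum_rpow_le_of_iIndepFun hr hr2 hind hmem hZ0 J).trans ?_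
    rw [mul_assoc, ← nsmul_eq_mul]
    exact mul_le_mul_of_nonneg_left (Finset.sum_le_card_nsmul J _ _ fun j _ => hmoment j)
      (by norm_num)
  rw [eLpNorm_eq_ofReal_integral_abs_rpow hr0 (memLp_finsetSum J fun j _ => hmem j)]
  calc ENNReal.ofReal ((∫ ω, |∑ j ∈ J, Z j ω| ^ r ∂P) ^ r⁻¹)
      ≤ ENNReal.ofReal ((4 * J.card * c.toReal ^ r) ^ r⁻¹) :=
        ENNReal.ofReal_le_ofReal <|
          Real.rpow_le_rpow (hnonneg _) hsum (by positivity)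
    _ = ENNReal.ofReal ((4 * J.card) ^ r⁻¹) * c := by
        rw [Real.mul_rpow (by positivity) (by positivity),
          Real.rpow_rpow_inv ENNReal.toReal_nonneg hr0.ne', ENNReal.ofReal_mul (by positivity),
          ENNReal.ofReal_toReal hc_top]

end VonBahrEsseen

section Minkowski

variable {S Ω : Type*} [MeasurableSpace S] [MeasurableSpace Ω] {μ : Measure S} {P : Measure Ω}

theorem lintegral_lintegral_mul_le [SFinite μ] [SFinite P] {k k' : ℝ} (hk : k.HolderConjugate k')
    {G : S → Ω → ℝ≥0∞} (hG : Measurable (Function.uncurry G)) {g : Ω → ℝ≥0∞} (hg : Measurable g) :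
    ∫⁻ ω, (∫⁻ s, G s ω ∂μ) * g ω ∂P
      ≤ (∫⁻ s, (∫⁻ ω, G s ω ^ k ∂P) ^ (1 / k) ∂μ) * (∫⁻ ω, g ω ^ k' ∂P) ^ (1 / k') := by
  calc ∫⁻ ω, (∫⁻ s, G s ω ∂μ) * g ω ∂P
      = ∫⁻ ω, ∫⁻ s, G s ω * g ω ∂μ ∂P :=
        lintegral_congr fun ω =>
          (lintegral_mul_const (f := fun s => G s ω) _ (hG.comp measurable_prodMk_right)).symm
    _ = ∫⁻ s, ∫⁻ ω, G s ω * g ω ∂P ∂μ :=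
        lintegral_lintegral_swap
          ((hG.comp measurable_swap).mul (hg.comp measurable_fst)).aemeasurable
    _ ≤ ∫⁻ s, (∫⁻ ω, G s ω ^ k ∂P) ^ (1 / k) * (∫⁻ ω, g ω ^ k' ∂P) ^ (1 / k') ∂μ :=
        lintegral_mono fun s => ENNReal.lintegral_mul_le_Lp_mul_Lq P hk
          (hG.comp measurable_prodMk_left).aemeasurable (f := G s) hg.aemeasurable
    _ = _ := lintegral_mul_const _ ((hG.pow_const k).lintegral_prod_right'.pow_const _)

theorem lintegral_rpow_le_of_le_lintegral [SFinite μ] [SFinite P] {k : ℝ} (hk : 1 < k)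
    {G : S → Ω → ℝ≥0∞} (hG : Measurable (Function.uncurry G)) {g : Ω → ℝ≥0∞} (hg : Measurable g)
    (hle : ∀ ω, g ω ≤ ∫⁻ s, G s ω ∂μ) (hfin : ∫⁻ ω, g ω ^ k ∂P ≠ ∞) :
    (∫⁻ ω, g ω ^ k ∂P) ^ (1 / k) ≤ ∫⁻ s, (∫⁻ ω, G s ω ^ k ∂P) ^ (1 / k) ∂μ := by
  have hconj : k.HolderConjugate (Real.conjExponent k) := .conjExponent hk
  have hk' := hconj.symm.pos
  rcases eq_or_ne (∫⁻ ω, g ω ^ k ∂P) 0 with hzero | hzero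
  · rw [hzero, ENNReal.zero_rpow_of_pos (by positivity)]
    exact zero_le
  have hdual : ∫⁻ ω, g ω ^ k ∂P ≤ (∫⁻ s, (∫⁻ ω, G s ω ^ k ∂P) ^ (1 / k) ∂μ) *
      (∫⁻ ω, g ω ^ k ∂P) ^ (1 / Real.conjExponent k) := by
    calc ∫⁻ ω, g ω ^ k ∂P
        ≤ ∫⁻ ω, (∫⁻ s, G s ω ∂μ) * g ω ^ (k - 1) ∂P := lintegral_mono fun ω => by
          rw [← add_sub_cancel 1 k, ENNReal.rpow_add_of_nonneg _ _ zero_le_one (by linarith),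
            ENNReal.rpow_one, add_sub_cancel]
          exact mul_le_mul_left (hle ω) _
      _ ≤ _ := lintegral_lintegral_mul_le hconj hG (hg.pow_const (k - 1))
      _ = _ := by simp only [← ENNReal.rpow_mul, hconj.sub_one_mul_conj]
  have hsplit : (∫⁻ ω, g ω ^ k ∂P) ^ (1 / k) * (∫⁻ ω, g ω ^ k ∂P) ^ (1 / Real.conjExponent k) =
      ∫⁻ ω, g ω ^ k ∂P := by
    rw [← ENNReal.rpow_add _ _ hzero hfin, one_div, one_div, hconj.inv_add_inv_eq_one,
      ENNReal.rpow_one]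
  exact (ENNReal.mul_le_mul_iff_left
    (fun h => (ENNReal.rpow_eq_zero_iff.1 h).elim (hzero ·.1) (hfin ·.1))
    (ENNReal.rpow_ne_top_of_nonneg (by positivity) hfin)).1 (hsplit.le.trans hdual)

theorem lintegral_le_of_forall_simpleFunc_le [SigmaFinite P] {f : Ω → ℝ≥0∞} {c : ℝ≥0∞}
    (h : ∀ φ : SimpleFunc Ω NNReal, (∀ ω, (φ ω : ℝ≥0∞) ≤ f ω) → ∫⁻ ω, φ ω ∂P ≠ ∞ →
      ∫⁻ ω, φ ω ∂P ≤ c) : ∫⁻ ω, f ω ∂P ≤ c := by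
  refine le_of_forall_lt fun L hL => ?_
  rw [lintegral_eq_nnreal] at hL
  simp only [lt_iSup_iff] at hL
  obtain ⟨ψ, hψ, hLψ⟩ := hL
  rw [← SimpleFunc.lintegral_eq_lintegral] at hLψ
  obtain ⟨φ, hφ, hφ_fin, hLφ⟩ := SimpleFunc.exists_lt_lintegral_simpleFunc_of_lt_lintegral hLψ
  exact hLφ.trans_le
    (h φ (fun ω => (ENNReal.coe_le_coe.2 (hφ ω)).trans (hψ ω)) hφ_fin.ne)

theorem lintegral_rpow_lintegral_le [SFinite μ] [SigmaFinite P] {k : ℝ} (hk : 1 ≤ k)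
    {G : S → Ω → ℝ≥0∞} (hG : Measurable (Function.uncurry G)) :
    (∫⁻ ω, (∫⁻ s, G s ω ∂μ) ^ k ∂P) ^ (1 / k) ≤ ∫⁻ s, (∫⁻ ω, G s ω ^ k ∂P) ^ (1 / k) ∂μ := by
  rcases hk.eq_or_lt with rfl | hk
  · simp only [ENNReal.rpow_one, div_one]
    exact (lintegral_lintegral_swap hG.aemeasurable).symm.le
  have hk0 : 0 < k := zero_lt_one.trans hk
  rw [one_div, ENNReal.rpow_inv_le_iff hk0]
  refine lintegral_le_of_forall_simpleFunc_le fun φ hφ hφ_fin => ?_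
  have hpow (ω : Ω) : ((φ ω : ℝ≥0∞) ^ k⁻¹) ^ k = φ ω := ENNReal.rpow_inv_rpow hk0.ne' _
  have h := lintegral_rpow_le_of_le_lintegral (P := P) (g := fun ω => (φ ω : ℝ≥0∞) ^ k⁻¹) hk hG
    (φ.measurable.coe_nnreal_ennreal.pow_const _)
    (fun ω => (ENNReal.rpow_inv_le_iff hk0).2 (hφ ω)) (by simpa only [hpow])
  simpa only [hpow, one_div, ENNReal.rpow_inv_le_iff hk0] using h

theorem eLpNorm_eLpNorm_swap_le [SFinite μ] [SigmaFinite P] {p q : ℝ≥0∞} (hp0 : p ≠ 0)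
    (hpq : p ≤ q) (hq : q ≠ ∞) {f : S × Ω → ℝ} (hf : Measurable f) :
    eLpNorm (fun ω => eLpNorm (fun s => f (s, ω)) p μ) q P
      ≤ eLpNorm (fun s => eLpNorm (fun ω => f (s, ω)) q P) p μ := by
  have hp : p ≠ ∞ := ne_top_of_le_ne_top hq hpq
  have hq0 : q ≠ 0 := (hp0.bot_lt.trans_le hpq).ne'
  have ha : 0 < p.toReal := ENNReal.toReal_pos hp0 hp
  have hb : 0 < q.toReal := ENNReal.toReal_pos hq0 hq
  simp only [eLpNorm_eq_lintegral_rpow_enorm_toReal hp0 hp,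
    eLpNorm_eq_lintegral_rpow_enorm_toReal hq0 hq, enorm_eq_self]
  set a := p.toReal
  set b := q.toReal
  have hab : a ≤ b := ENNReal.toReal_mono hq hpq
  have hinner (x : ℝ≥0∞) : (x ^ (1 / a)) ^ b = x ^ (b / a) := by
    rw [← ENNReal.rpow_mul, one_div_mul_eq_div]
  have houter (x : ℝ≥0∞) : (x ^ (1 / b)) ^ a = x ^ (1 / (b / a)) := by
    rw [← ENNReal.rpow_mul, one_div_mul_eq_div, one_div_div]
  have hcancel (x : ℝ≥0∞) : (x ^ a) ^ (b / a) = x ^ b := by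
    rw [← ENNReal.rpow_mul, mul_div_cancel₀ _ ha.ne']
  have hminkowski := lintegral_rpow_lintegral_le (μ := μ) (P := P)
    ((one_le_div ha).2 hab) (G := fun s ω => ‖f (s, ω)‖ₑ ^ a) (hf.enorm.pow_const a)
  simp only [hcancel] at hminkowski
  simp only [hinner, houter]
  calc (∫⁻ ω, (∫⁻ s, ‖f (s, ω)‖ₑ ^ a ∂μ) ^ (b / a) ∂P) ^ (1 / b)
      = ((∫⁻ ω, (∫⁻ s, ‖f (s, ω)‖ₑ ^ a ∂μ) ^ (b / a) ∂P) ^ (1 / (b / a))) ^ (1 / a) := by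
        rw [← ENNReal.rpow_mul]
        congr 1
        field_simp
    _ ≤ _ := ENNReal.rpow_le_rpow hminkowski (by positivity)

end Minkowski

section Evaluation

variable {S : Type*} [MeasurableSpace S] {μ : Measure S} {p : ℝ≥0∞} [Fact (1 ≤ p)]

theorem ae_tendsto_of_edist_lt_geometric {E : Type*} [NormedAddCommGroup E] [CompleteSpace E]
    {g : ℕ → Lp E p μ} {h : Lp E p μ} (hgh : ∀ n, edist (g n) h < 2⁻¹ ^ n) :
    ∀ᵐ s ∂μ, Tendsto (fun n => g n s) atTop (𝓝 (h s)) := by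
  have hg : Tendsto g atTop (𝓝 h) :=
    tendsto_iff_edist_tendsto_0.2 <| tendsto_of_tendsto_of_tendsto_of_le_of_le tendsto_const_nhds
      (ENNReal.tendsto_pow_atTop_nhds_zero_of_lt_one (r := 2⁻¹) (by simp))
      (fun n => zero_le) (fun n => (hgh n).le)
  obtain ⟨φ, hφ, hsubseq⟩ := (tendstoInMeasure_of_tendsto_Lp hg).exists_seq_tendsto_ae
  have hsummable : ∑' n : ℕ, (2 * 2⁻¹ ^ n : ℝ≥0∞) ≠ ∞ := by
    rw [ENNReal.tsum_mul_left, ENNReal.tsum_geometric, ENNReal.one_sub_inv_two, inv_inv]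
    simp [ENNReal.mul_eq_top]
  have hcauchy (N n m : ℕ) (hn : N ≤ n) (hm : N ≤ m) :
      eLpNorm ((g n : S → E) - (g m : S → E)) p μ < 2 * 2⁻¹ ^ N := by
    have hmono {k : ℕ} (hk : N ≤ k) : (2⁻¹ : ℝ≥0∞) ^ k ≤ 2⁻¹ ^ N :=
      pow_le_pow_right_of_le_one' (by simp) hk
    rw [← Lp.edist_def, two_mul]
    exact (edist_triangle_right _ _ h).trans_lt
      (ENNReal.add_lt_add ((hgh n).trans_le (hmono hn)) ((hgh m).trans_le (hmono hm)))
  have hlim := Lp.ae_tendsto_of_cauchy_eLpNorm (f := fun n => (g n : S → E))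
    (fun n => Lp.aestronglyMeasurable _) Fact.out hsummable hcauchy
  filter_upwards [hsubseq, hlim] with s hs ⟨l, hl⟩
  rwa [tendsto_nhds_unique hs (hl.comp hφ.tendsto_atTop)]

theorem exists_measurable_index_edist_lt {E : Type*} [PseudoEMetricSpace E] [MeasurableSpace E]
    [OpensMeasurableSpace E] (d : ℕ → E) {δ : ℝ≥0∞} (hδ : 0 < δ) :
    ∃ k : E → ℕ, Measurable k ∧ ∀ x ∈ closure (Set.range d), edist (d (k x)) x < δ := by
  classical
  let near (x : E) (k : ℕ) : Prop := edist (d k) x < δ ∨ ∀ j, ¬ edist (d j) x < δ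
  have hnear (x : E) : ∃ k, near x k := by
    by_cases hx : ∃ k, edist (d k) x < δ
    · exact hx.imp fun k hk => Or.inl hk
    · exact ⟨0, Or.inr (not_exists.1 hx)⟩
  have hball (k : ℕ) : MeasurableSet {x | edist (d k) x < δ} :=
    (isOpen_lt (by fun_prop) continuous_const).measurableSet
  refine ⟨fun x => Nat.find (hnear x), measurable_find hnear fun k => ?_, fun x hx => ?_⟩
  · simp only [near, Set.ofPred_or, Set.ofPred_forall]
    exact (hball k).union (MeasurableSet.iInter fun j => (hball j).compl)
  · obtain ⟨_, ⟨j, rfl⟩, hj⟩ := EMetric.mem_closure_iff.1 hx δ hδ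
    exact (Nat.find_spec (hnear x)).resolve_right fun hfar => hfar j (edist_comm x (d j) ▸ hj)

theorem exists_measurable_evaluation {t : Set (Lp ℝ p μ)} (ht : TopologicalSpace.IsSeparable t) :
    ∃ Φ : S × Lp ℝ p μ → ℝ, Measurable Φ ∧ ∀ g ∈ t, (g : S → ℝ) =ᵐ[μ] fun s => Φ (s, g) := by
  obtain ⟨c, hc, htc⟩ := ht
  rcases c.eq_empty_or_nonempty with rfl | hne
  · exact ⟨0, measurable_const, fun g hg => by simpa using htc hg⟩
  obtain ⟨d, rfl⟩ := hc.exists_eq_range hne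
  have hpos (n : ℕ) : (0 : ℝ≥0∞) < 2⁻¹ ^ n := ENNReal.pow_pos (by simp) n
  choose k hk hkd using fun n => exists_measurable_index_edist_lt d (hpos n)
  have hd : Measurable fun x : S × ℕ => d x.2 x.1 :=
    measurable_from_prod_countable_left fun j => (Lp.stronglyMeasurable (d j)).measurable
  refine ⟨fun x => limsup (fun n => d (k n x.2) x.1) atTop,
    Measurable.limsup fun n => hd.comp (measurable_fst.prodMk ((hk n).comp measurable_snd)),
    fun g hg => ?_⟩
  filter_upwards [ae_tendsto_of_edist_lt_geometric fun n => hkd n g (htc hg)] with s hs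
  exact hs.limsup_eq.symm

theorem exists_measurable_evaluation_of_identDistrib {Ω : Type*} [MeasurableSpace Ω] {P : Measure Ω}
    {η : Ω → Lp ℝ p μ} (hη : AEStronglyMeasurable η P) :
    ∃ Φ : S × Lp ℝ p μ → ℝ, Measurable Φ ∧ ∀ Y : Ω → Lp ℝ p μ, IdentDistrib Y η P P →
      ∀ᵐ ω ∂P, (Y ω : S → ℝ) =ᵐ[μ] fun s => Φ (s, Y ω) := by
  obtain ⟨t, ht, hηt⟩ := hη.isSeparable_ae_range
  obtain ⟨Φ, hΦ, hΦt⟩ := exists_measurable_evaluation ht.closure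
  refine ⟨Φ, hΦ, fun Y hY => ?_⟩
  filter_upwards [hY.symm.ae_mem_snd isClosed_closure.measurableSet
    (hηt.mono fun ω hω => subset_closure hω)] with ω hω
  exact hΦt _ hω

end Evaluation

section SetIntegral

variable {S : Type*} [MeasurableSpace S] {μ : Measure S} {p : ℝ≥0∞} [Fact (1 ≤ p)] {B : Set S}

/-- The continuous linear functional `g ↦ ∫_B g dμ` on `L^p(S)`, for `B` of finite measure: the
pairing with the indicator function of `B` in the dual exponent. -/
noncomputable def setIntegralCLM (p : ℝ≥0∞) [Fact (1 ≤ p)] (hB : MeasurableSet B)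
    (hμB : μ B ≠ ∞) : Lp ℝ p μ →L[ℝ] ℝ :=
  haveI := ENNReal.HolderConjugate.conjExponent (p := p) Fact.out
  haveI : Fact (1 ≤ p.conjExponent) := ⟨le_self_add⟩
  ((ContinuousLinearMap.mul ℝ ℝ).lpPairing μ p p.conjExponent).flip
    (indicatorConstLp p.conjExponent hB hμB 1)

theorem setIntegralCLM_apply (hB : MeasurableSet B) (hμB : μ B ≠ ∞) (g : Lp ℝ p μ) :
    setIntegralCLM p hB hμB g = ∫ s in B, g s ∂μ := by
  have := ENNReal.HolderConjugate.conjExponent (p := p) Fact.out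
  have : Fact (1 ≤ p.conjExponent) := ⟨le_self_add⟩
  rw [setIntegralCLM, ContinuousLinearMap.flip_apply, ContinuousLinearMap.lpPairing_eq_integral,
    ← integral_indicator hB]
  refine integral_congr_ae ?_
  filter_upwards [indicatorConstLp_coeFn (p := p.conjExponent) (hs := hB) (hμs := hμB)
    (c := (1 : ℝ))] with s hs
  rw [hs, ContinuousLinearMap.mul_apply', ← Set.indicator_mul_right B (fun s => g s)]
  simp only [mul_one]

theorem integrableOn_lp (hμB : μ B ≠ ∞) (g : Lp ℝ p μ) : IntegrableOn g B μ := by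
  have : Fact (μ B < ∞) := ⟨hμB.lt_top⟩
  exact ((Lp.memLp g).restrict B).integrable Fact.out

theorem setIntegral_abs_lp_le (hB : MeasurableSet B) (hμB : μ B ≠ ∞) (g : Lp ℝ p μ) :
    ∫ s in B, |g s| ∂μ ≤ ‖setIntegralCLM (μ := μ) p hB hμB‖ * ‖g‖ := by
  calc ∫ s in B, |g s| ∂μ = setIntegralCLM p hB hμB |g| := by
        rw [setIntegralCLM_apply]
        exact integral_congr_ae (ae_restrict_of_ae (Lp.coeFn_abs g).symm)
    _ ≤ ‖setIntegralCLM (μ := μ) p hB hμB‖ * ‖|g|‖ :=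
        (le_abs_self _).trans ((setIntegralCLM p hB hμB).le_opNorm _)
    _ = _ := by rw [norm_abs_eq_norm]

end SetIntegral

section Versions

variable {S : Type*} [MeasurableSpace S] {μ : Measure S} [SigmaFinite μ]
  {Ω : Type*} [MeasurableSpace Ω] {P : Measure Ω} {p : ℝ≥0∞} {Y : Ω → Lp ℝ p μ} {f : S × Ω → ℝ}

theorem IsVersion.ae_ae_eq [SFinite P] {g : S × Ω → ℝ} (hf : IsVersion P Y f)
    (hg : IsVersion P Y g) : ∀ᵐ s ∂μ, ∀ᵐ ω ∂P, f (s, ω) = g (s, ω) := by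
  rw [Measure.ae_ae_comm (p := fun s ω => f (s, ω) = g (s, ω)) (measurableSet_eq_fun hf.1 hg.1)]
  filter_upwards [hf.2, hg.2] with ω hfω hgω
  exact hfω.symm.trans hgω

theorem IsVersion.mixedNorm_eq [SFinite P] (hf : IsVersion P Y f) (r : ℝ≥0∞) :
    mixedNorm P r Y = eLpNorm (fun s => eLpNorm (fun ω => f (s, ω)) r P) p μ := by
  refine le_antisymm (iInf₂_le f hf) (le_iInf₂ fun g hg => (eLpNorm_congr_ae ?_).le)
  filter_upwards [hf.ae_ae_eq hg] with s hs
  exact eLpNorm_congr_ae hs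

omit [SigmaFinite μ] in
theorem isVersion_evaluation [Fact (1 ≤ p)] {Φ : S × Lp ℝ p μ → ℝ} (hΦ : Measurable Φ)
    (hY : AEMeasurable Y P) (hΦY : ∀ᵐ ω ∂P, (Y ω : S → ℝ) =ᵐ[μ] fun s => Φ (s, Y ω)) :
    IsVersion P Y fun x => Φ (x.1, hY.mk Y x.2) := by
  refine ⟨hΦ.comp (measurable_fst.prodMk (hY.measurable_mk.comp measurable_snd)), ?_⟩
  filter_upwards [hΦY, hY.ae_eq_mk] with ω hω hmk
  rwa [← hmk]

omit [SigmaFinite μ] in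
theorem IsVersion.finsetSum {ι : Type*} {Y : ι → Ω → Lp ℝ p μ} {f : ι → S × Ω → ℝ} (J : Finset ι)
    (hf : ∀ j ∈ J, IsVersion P (Y j) (f j)) :
    IsVersion P (fun ω => ∑ j ∈ J, Y j ω) fun x => ∑ j ∈ J, f j x := by
  refine ⟨Finset.measurable_fun_sum J fun j hj => (hf j hj).1, ?_⟩
  filter_upwards [(Finset.eventually_all J).2 fun j hj => (hf j hj).2] with ω hω
  filter_upwards [Lp.coeFn_finsetSum J fun j => Y j ω, (Finset.eventually_all J).2 hω]
    with s hsum hs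
  rw [hsum, Finset.sum_apply]
  exact Finset.sum_congr rfl hs

variable [Fact (1 ≤ p)]

theorem IsVersion.integrable_prod_restrict [SFinite P] (hf : IsVersion P Y f)
    (hY : Integrable Y P) {B : Set S} (hB : MeasurableSet B) (hμB : μ B ≠ ∞) :
    Integrable f ((μ.restrict B).prod P) := by
  rw [integrable_prod_iff' hf.1.aestronglyMeasurable]
  constructor
  · filter_upwards [hf.2] with ω hω
    exact (integrableOn_lp hμB (Y ω)).congr (ae_restrict_of_ae hω)
  · refine (hY.norm.const_mul ‖setIntegralCLM (μ := μ) p hB hμB‖).mono'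
      (hf.1.norm.stronglyMeasurable.integral_prod_left').aestronglyMeasurable ?_
    filter_upwards [hf.2] with ω hω
    rw [Real.norm_of_nonneg (integral_nonneg fun s => norm_nonneg _)]
    refine (integral_congr_ae (ae_restrict_of_ae ?_)).trans_le (setIntegral_abs_lp_le hB hμB (Y ω))
    filter_upwards [hω] with s hs
    rw [hs, Real.norm_eq_abs]

theorem IsVersion.integral_ae_eq [SFinite P] (hf : IsVersion P Y f) (hY : Integrable Y P) :
    (fun s => ∫ ω, f (s, ω) ∂P) =ᵐ[μ] ((∫ ω, Y ω ∂P : Lp ℝ p μ) : S → ℝ) := by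
  refine ae_eq_of_forall_setIntegral_eq_of_sigmaFinite
    (fun B hB hμB => (hf.integrable_prod_restrict hY hB hμB.ne).integral_prod_left)
    (fun B _ hμB => integrableOn_lp hμB.ne _) fun B hB hμB => ?_
  calc ∫ s in B, ∫ ω, f (s, ω) ∂P ∂μ
      = ∫ ω, ∫ s in B, f (s, ω) ∂μ ∂P :=
        integral_integral_swap (f := fun s ω => f (s, ω))
          (hf.integrable_prod_restrict hY hB hμB.ne)
    _ = ∫ ω, setIntegralCLM p hB hμB.ne (Y ω) ∂P := by
        refine integral_congr_ae ?_
        filter_upwards [hf.2] with ω hω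
        rw [setIntegralCLM_apply]
        exact (integral_congr_ae (ae_restrict_of_ae hω)).symm
    _ = ∫ s in B, (∫ ω, Y ω ∂P : Lp ℝ p μ) s ∂μ := by
        rw [ContinuousLinearMap.integral_comp_comm _ hY, setIntegralCLM_apply]

end Versions

section MixedNorm

variable {S : Type*} [MeasurableSpace S] {μ : Measure S} {Ω : Type*} [MeasurableSpace Ω]
  {P : Measure Ω} {p : ℝ≥0∞} [Fact (1 ≤ p)]

theorem eLpNorm_le_mixedNorm [SigmaFinite μ] [SigmaFinite P] {q : ℝ≥0∞} (hpq : p ≤ q) (hq : q ≠ ∞)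
    (Y : Ω → Lp ℝ p μ) : eLpNorm Y q P ≤ mixedNorm P q Y := by
  refine le_iInf₂ fun f hf => ?_
  calc eLpNorm Y q P = eLpNorm (fun ω => eLpNorm (fun s => f (s, ω)) p μ) q P := by
        refine eLpNorm_congr_enorm_ae ?_
        filter_upwards [hf.2] with ω hω
        rw [Lp.enorm_def, enorm_eq_self, eLpNorm_congr_ae hω]
    _ ≤ _ := eLpNorm_eLpNorm_swap_le (zero_lt_one.trans_le Fact.out).ne' hpq hq hf.1

omit [Fact (1 ≤ p)] in
theorem mixedNorm_mono_exponent [IsProbabilityMeasure P] {q r : ℝ≥0∞} (hqr : q ≤ r)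
    (Y : Ω → Lp ℝ p μ) : mixedNorm P q Y ≤ mixedNorm P r Y :=
  iInf₂_mono fun f hf => eLpNorm_mono_enorm fun s => by
    rw [enorm_eq_self, enorm_eq_self]
    exact eLpNorm_le_eLpNorm_of_exponent_le hqr
      (hf.1.comp measurable_prodMk_left).aestronglyMeasurable

variable [SigmaFinite μ] [IsProbabilityMeasure P] {ι : Type*} [Countable ι]
  {Y : ι → Ω → Lp ℝ p μ} {J : Finset ι}

theorem mixedNorm_sum_le {r : ℝ} (hr : 1 < r) (hr2 : r ≤ 2) {η : Ω → Lp ℝ p μ}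
    (hη : Integrable η P) (hη0 : ∫ ω, η ω ∂P = 0) (hind : iIndepFun Y P)
    (hcopy : ∀ j, IdentDistrib (Y j) η P P) (hJ : J.Nonempty) :
    mixedNorm P (ENNReal.ofReal r) (fun ω => ∑ j ∈ J, Y j ω)
      ≤ ENNReal.ofReal ((4 * J.card) ^ r⁻¹) * mixedNorm P (ENNReal.ofReal r) η := by
  obtain ⟨Φ, hΦ, hΦ_eval⟩ := exists_measurable_evaluation_of_identDistrib hη.aestronglyMeasurable
  have hYm (j : ι) : AEMeasurable (Y j) P := (hcopy j).aemeasurable_fst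
  have hηm : AEMeasurable η P := hη.aestronglyMeasurable.aemeasurable
  have hsection (s : S) : Measurable fun g => Φ (s, g) := hΦ.comp measurable_prodMk_left
  have hY_version (j : ι) := isVersion_evaluation hΦ (hYm j) (hΦ_eval (Y j) (hcopy j))
  have hη_version := isVersion_evaluation hΦ hηm (hΦ_eval η (.refl hηm))
  have hcentered : ∀ᵐ s ∂μ, ∀ j, ∫ ω, Φ (s, (hYm j).mk (Y j) ω) ∂P = 0 := by
    refine ae_all_iff.2 fun j => ?_
    filter_upwards [(hY_version j).integral_ae_eq ((hcopy j).symm.integrable_snd hη),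
      Lp.coeFn_zero ℝ p μ] with s hs hs0
    rw [hs, (hcopy j).integral_eq, hη0, hs0, Pi.zero_apply]
  have hnorm (s : S) (j : ι) :
      eLpNorm (fun ω => Φ (s, (hYm j).mk (Y j) ω)) (ENNReal.ofReal r) P =
        eLpNorm (fun ω => Φ (s, hηm.mk η ω)) (ENNReal.ofReal r) P :=
    ((((IdentDistrib.of_ae_eq (hYm j) (hYm j).ae_eq_mk).symm.trans (hcopy j)).trans
      (.of_ae_eq hηm hηm.ae_eq_mk)).comp (hsection s)).eLpNorm_eq _
  rw [(IsVersion.finsetSum J fun j _ => hY_version j).mixedNorm_eq, hη_version.mixedNorm_eq]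
  refine eLpNorm_le_mul_eLpNorm_of_ae_le_mul' (c := ((4 * J.card : ℝ) ^ r⁻¹).toNNReal) ?_ p
  filter_upwards [hcentered] with s hs
  simp only [enorm_eq_self]
  exact eLpNorm_sum_le_of_iIndepFun hr hr2
    ((hind.congr fun j => (hYm j).ae_eq_mk).comp (fun _ g => Φ (s, g)) fun _ => hsection s)
    (fun j => ((hsection s).comp (hYm j).measurable_mk).aestronglyMeasurable) hs
    (fun j => (hnorm s j).le) hJ

theorem eLpNorm_sum_le_mixedNorm {q r : ℝ} (hpq : p ≤ ENNReal.ofReal q) (hqr : q ≤ r)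
    (hr : 1 < r) (hr2 : r ≤ 2) {η : Ω → Lp ℝ p μ} (hη : Integrable η P) (hη0 : ∫ ω, η ω ∂P = 0)
    (hind : iIndepFun Y P) (hcopy : ∀ j, IdentDistrib (Y j) η P P) (hJ : J.Nonempty) :
    eLpNorm (fun ω => ∑ j ∈ J, Y j ω) (ENNReal.ofReal q) P
      ≤ ENNReal.ofReal ((4 * J.card) ^ r⁻¹) * mixedNorm P (ENNReal.ofReal r) η :=
  (eLpNorm_le_mixedNorm hpq ENNReal.ofReal_ne_top _).trans <|
    (mixedNorm_mono_exponent (ENNReal.ofReal_le_ofReal hqr) _).trans <|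
      mixedNorm_sum_le hr hr2 hη hη0 hind hcopy hJ

theorem four_mul_rpow_inv_div_le {r m : ℝ} (hr : 1 ≤ r) (hm : 0 < m) :
    (4 * m) ^ r⁻¹ / m ≤ 4 * m ^ (r⁻¹ - 1) := by
  have hr_inv : r⁻¹ ≤ 1 := inv_le_one_of_one_le₀ hr
  have hfour : (4 : ℝ) ^ r⁻¹ ≤ 4 := by
    simpa only [Real.rpow_one] using
      Real.rpow_le_rpow_of_exponent_le (by norm_num : (1 : ℝ) ≤ 4) hr_inv
  rw [Real.mul_rpow (by norm_num) hm.le, mul_div_assoc, ← Real.rpow_sub_one hm.ne']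
  exact mul_le_mul_of_nonneg_right hfour (by positivity)

theorem eLpNorm_integral_sub_mean_le {q r : ℝ} (hpq : p ≤ ENNReal.ofReal q) (hqr : q ≤ r)
    (hr : 1 < r) (hr2 : r ≤ 2) {ζ : Ω → Lp ℝ p μ} (hζ : Integrable ζ P) (hind : iIndepFun Y P)
    (hcopy : ∀ j, IdentDistrib (Y j) ζ P P) (hJ : J.Nonempty) :
    eLpNorm (fun ω => (∫ ω', ζ ω' ∂P) - (J.card : ℝ)⁻¹ • ∑ j ∈ J, Y j ω) (ENNReal.ofReal q) P
      ≤ ENNReal.ofReal (4 * (J.card : ℝ) ^ (r⁻¹ - 1)) *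
        mixedNorm P (ENNReal.ofReal r) fun ω => ζ ω - ∫ ω', ζ ω' ∂P := by
  set c := ∫ ω, ζ ω ∂P
  have hcard : (0 : ℝ) < J.card := by exact_mod_cast hJ.card_pos
  have hcentering : Measurable fun g : Lp ℝ p μ => g - c := (continuous_sub_right c).measurable
  have hsum := eLpNorm_sum_le_mixedNorm (Y := fun j ω => Y j ω - c) hpq hqr hr hr2
    (hζ.sub (integrable_const c)) (by simp [integral_sub hζ (integrable_const c), c])
    (hind.comp (fun _ g => g - c) fun _ => hcentering) (fun j => (hcopy j).comp hcentering) hJ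
  have hmean (ω : Ω) : c - (J.card : ℝ)⁻¹ • ∑ j ∈ J, Y j ω =
      (-(J.card : ℝ)⁻¹) • ∑ j ∈ J, (Y j ω - c) := by
    rw [Finset.sum_sub_distrib, Finset.sum_const, ← Nat.cast_smul_eq_nsmul ℝ, smul_sub, smul_smul,
      neg_mul, inv_mul_cancel₀ hcard.ne', neg_smul, neg_smul, one_smul, sub_neg_eq_add,
      neg_add_eq_sub]
  simp only [hmean]
  calc eLpNorm (fun ω => (-(J.card : ℝ)⁻¹) • ∑ j ∈ J, (Y j ω - c)) (ENNReal.ofReal q) P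
      = ENNReal.ofReal (J.card : ℝ)⁻¹ *
          eLpNorm (fun ω => ∑ j ∈ J, (Y j ω - c)) (ENNReal.ofReal q) P := by
        rw [← Pi.smul_def, eLpNorm_const_smul, enorm_neg, Real.enorm_of_nonneg (by positivity)]
    _ ≤ ENNReal.ofReal (J.card : ℝ)⁻¹ * (ENNReal.ofReal ((4 * J.card) ^ r⁻¹) *
          mixedNorm P (ENNReal.ofReal r) fun ω => ζ ω - c) := by gcongr; exact hsum
    _ ≤ ENNReal.ofReal (4 * (J.card : ℝ) ^ (r⁻¹ - 1)) *
          mixedNorm P (ENNReal.ofReal r) fun ω => ζ ω - c := by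
        rw [← mul_assoc, ← ENNReal.ofReal_mul (by positivity), inv_mul_eq_div]
        gcongr
        exact four_mul_rpow_inv_div_le hr.le hcard

end MixedNorm

section SamplingBound

/-- The part of a cost bound that is due to sampling with conjugate exponent `x = r'`. The
parameter `κ = γ - β(r) r'` is the growth rate of the sampling cost in the level; the three cases
say whether the coarse levels, all levels, or the fine levels dominate. -/
noncomputable def samplingBound (α A x κ ε : ℝ) : ℝ :=
  if κ < 0 then ε ^ (-x)
  else if κ = 0 then ε ^ (-x) * |Real.logb A ε| ^ (x + 1)
  else ε ^ (-x - κ / α)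

/-- The polynomial order of `samplingBound` in `ε⁻¹`, disregarding the logarithm. -/
noncomputable def samplingOrder (α x κ : ℝ) : ℝ := max x (x + κ / α)

variable {α A x κ ε : ℝ}

theorem samplingBound_nonneg (hε : 0 < ε) : 0 ≤ samplingBound α A x κ ε := by
  unfold samplingBound
  split_ifs <;> positivity

theorem samplingBound_zero : samplingBound α A x 0 ε = ε ^ (-x) * |Real.logb A ε| ^ (x + 1) := by
  rw [samplingBound, if_neg (lt_irrefl 0), if_pos rfl]

theorem samplingOrder_of_nonpos (hα : 0 < α) (hκ : κ ≤ 0) : samplingOrder α x κ = x :=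
  max_eq_left (add_le_of_nonpos_right (div_nonpos_of_nonpos_of_nonneg hκ hα.le))

theorem samplingOrder_of_nonneg (hα : 0 < α) (hκ : 0 ≤ κ) : samplingOrder α x κ = x + κ / α :=
  max_eq_right (le_add_of_nonneg_right (by positivity))

theorem samplingBound_of_ne_zero (hα : 0 < α) (hκ : κ ≠ 0) :
    samplingBound α A x κ ε = ε ^ (-samplingOrder α x κ) := by
  rcases hκ.lt_or_gt with hneg | hpos
  · rw [samplingBound, if_pos hneg, samplingOrder_of_nonpos hα hneg.le]
  · rw [samplingBound, if_neg hpos.not_gt, if_neg hpos.ne', samplingOrder_of_nonneg hα hpos.le,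
      neg_add']

theorem logb_two_le_abs_logb (hA : 1 < A) (hε : ε ∈ Set.Ioc (0 : ℝ) (1 / 2)) :
    Real.logb A 2 ≤ |Real.logb A ε| := by
  rw [← abs_neg, ← Real.logb_inv]
  refine (Real.logb_le_logb_of_le hA two_pos ?_).trans (le_abs_self _)
  rw [le_inv_comm₀ two_pos hε.1]
  simpa only [one_div] using hε.2

theorem exists_abs_logb_rpow_le {w η : ℝ} (hA : 1 < A) (hw : 0 < w) (hη : 0 < η) :
    ∃ C : ℝ, 0 < C ∧ ∀ ε ∈ Set.Ioc (0 : ℝ) (1 / 2), |Real.logb A ε| ^ w ≤ C * ε ^ (-η) := by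
  have hlogA : 0 < Real.log A := Real.log_pos hA
  refine ⟨(1 / (η / w * Real.log A)) ^ w, by positivity, fun ε hε => ?_⟩
  have hε0 : 0 < ε := hε.1
  have habs : |Real.logb A ε| = Real.log ε⁻¹ / Real.log A := by
    rw [Real.logb, abs_div, abs_of_pos hlogA, Real.log_inv,
      abs_of_nonpos (Real.log_nonpos hε0.le (by linarith [hε.2]))]
  have hle : |Real.logb A ε| ≤ 1 / (η / w * Real.log A) * ε ^ (-(η / w)) := by
    rw [habs, Real.rpow_neg hε0.le, ← Real.inv_rpow hε0.le, div_le_iff₀ hlogA]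
    refine (Real.log_le_rpow_div (inv_nonneg.2 hε0.le) (by positivity : 0 < η / w)).trans_eq ?_
    field_simp
  calc |Real.logb A ε| ^ w ≤ (1 / (η / w * Real.log A) * ε ^ (-(η / w))) ^ w :=
        Real.rpow_le_rpow (abs_nonneg _) hle hw.le
    _ = (1 / (η / w * Real.log A)) ^ w * ε ^ (-η) := by
        rw [Real.mul_rpow (by positivity) (by positivity), ← Real.rpow_mul hε0.le, neg_mul,
          div_mul_cancel₀ _ hw.ne']

theorem exists_rpow_samplingOrder_le (hα : 0 < α) (hA : 1 < A) (hx : 0 < x) :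
    ∃ C : ℝ, 0 < C ∧ ∀ ε ∈ Set.Ioc (0 : ℝ) (1 / 2),
      ε ^ (-samplingOrder α x κ) ≤ C * samplingBound α A x κ ε := by
  rcases eq_or_ne κ 0 with rfl | hκ
  · have hlog : 0 < Real.logb A 2 := Real.logb_pos hA one_lt_two
    refine ⟨(Real.logb A 2 ^ (x + 1))⁻¹, by positivity, fun ε hε => ?_⟩
    rw [samplingBound_zero, samplingOrder_of_nonpos hα le_rfl, mul_left_comm]
    refine le_mul_of_one_le_right (Real.rpow_nonneg hε.1.le _) ?_
    rw [← div_eq_inv_mul, one_le_div (by positivity)]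
    exact Real.rpow_le_rpow hlog.le (logb_two_le_abs_logb hA hε) (by linarith)
  · exact ⟨1, one_pos, fun ε _ => by rw [samplingBound_of_ne_zero hα hκ, one_mul]⟩

theorem exists_samplingBound_le_rpow (hα : 0 < α) (hA : 1 < A) (hx : 0 < x) {v : ℝ}
    (hv : samplingOrder α x κ < v ∨ κ ≠ 0 ∧ samplingOrder α x κ ≤ v) :
    ∃ C : ℝ, 0 < C ∧ ∀ ε ∈ Set.Ioc (0 : ℝ) (1 / 2), samplingBound α A x κ ε ≤ C * ε ^ (-v) := by
  rcases eq_or_ne κ 0 with rfl | hκ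
  · replace hv : x < v := by
      simpa only [samplingOrder_of_nonpos hα le_rfl, ne_eq, not_true, false_and, or_false] using hv
    obtain ⟨C, hC, hle⟩ := exists_abs_logb_rpow_le hA (by linarith : 0 < x + 1) (sub_pos.2 hv)
    refine ⟨C, hC, fun ε hε => ?_⟩
    calc samplingBound α A x 0 ε ≤ ε ^ (-x) * (C * ε ^ (-(v - x))) := by
          rw [samplingBound_zero]
          exact mul_le_mul_of_nonneg_left (hle ε hε) (Real.rpow_nonneg hε.1.le _)
      _ = C * ε ^ (-v) := by
          rw [mul_left_comm, ← Real.rpow_add hε.1]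
          ring_nf
  · refine ⟨1, one_pos, fun ε hε => ?_⟩
    rw [samplingBound_of_ne_zero hα hκ, one_mul]
    exact Real.rpow_le_rpow_of_exponent_ge hε.1 (by linarith [hε.2])
      (neg_le_neg (hv.elim le_of_lt And.right))

theorem exists_samplingBound_le_samplingBound {y lam : ℝ} (hα : 0 < α) (hA : 1 < A) (hx : 0 < x)
    (hy : 0 < y) (hle : samplingOrder α x κ < samplingOrder α y lam ∨
      κ ≠ 0 ∧ samplingOrder α x κ ≤ samplingOrder α y lam) :
    ∃ C : ℝ, 0 < C ∧ ∀ ε ∈ Set.Ioc (0 : ℝ) (1 / 2),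
      samplingBound α A x κ ε ≤ C * samplingBound α A y lam ε := by
  obtain ⟨C₁, hC₁, h₁⟩ := exists_samplingBound_le_rpow hα hA hx hle
  obtain ⟨C₂, hC₂, h₂⟩ := exists_rpow_samplingOrder_le (κ := lam) hα hA hy
  refine ⟨C₁ * C₂, by positivity, fun ε hε => (h₁ ε hε).trans ?_⟩
  rw [mul_assoc]
  exact mul_le_mul_of_nonneg_left (h₂ ε hε) hC₁.le

end SamplingBound

section OptimalExponent

variable {q qh α γ b₀ b₁ A : ℝ} {β : ℝ → ℝ}

theorem costBound_eq_add_samplingBound {r : ℝ} (hr : 1 < r) (ε : ℝ) :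
    costBound α γ β A r ε = ε ^ (-(γ / α)) +
      samplingBound α A r.conjExponent (γ - β r * r.conjExponent) ε := by
  have hconj : 0 < r.conjExponent := (Real.HolderConjugate.conjExponent hr).symm.pos
  have hlt : γ / r.conjExponent < β r ↔ γ - β r * r.conjExponent < 0 := by
    rw [div_lt_iff₀ hconj, sub_neg]
  have heq : β r = γ / r.conjExponent ↔ γ - β r * r.conjExponent = 0 := by
    rw [eq_div_iff hconj.ne', sub_eq_zero, eq_comm]
  simp only [costBound, samplingBound, hlt, heq]
  split_ifs <;> rfl

theorem sub_rate_mul_conjExponent {r : ℝ} (hr : 1 < r) :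
    γ - (b₀ + b₁ / r) * r.conjExponent = γ + b₁ - (b₀ + b₁) * r.conjExponent := by
  have : r - 1 ≠ 0 := by linarith
  rw [Real.conjExponent]
  field_simp
  ring

/-- The value of `r'`, for `r ∈ [q, qh]`, at which the smallest cost bound is attained: the
minimiser over `[qh', q']` of `x ↦ max x (x + (γ + b₁ - (b₀ + b₁) x) / α)`. -/
noncomputable def optimalConj (q qh α γ b₀ b₁ : ℝ) : ℝ :=
  if (γ + b₁) / (b₀ + b₁) ≤ qh.conjExponent ∨ b₀ + b₁ ≤ α then qh.conjExponent
  else min ((γ + b₁) / (b₀ + b₁)) q.conjExponent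

theorem optimalCostBound_eq_add_samplingBound (hb : 0 < b₀ + b₁) (ε : ℝ) :
    optimalCostBound q qh α γ b₀ b₁ A ε = ε ^ (-(γ / α)) +
      samplingBound α A (optimalConj q qh α γ b₀ b₁)
        (γ + b₁ - (b₀ + b₁) * optimalConj q qh α γ b₀ b₁) ε := by
  have hlt (x : ℝ) : γ + b₁ - (b₀ + b₁) * x < 0 ↔ (γ + b₁) / (b₀ + b₁) < x := by
    rw [sub_neg, div_lt_iff₀' hb]
  have heq (x : ℝ) : γ + b₁ - (b₀ + b₁) * x = 0 ↔ (γ + b₁) / (b₀ + b₁) = x := by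
    rw [sub_eq_zero, div_eq_iff hb.ne', mul_comm]
  simp only [optimalCostBound, optimalConj, samplingBound, hlt, heq]
  set t := (γ + b₁) / (b₀ + b₁)
  rcases lt_trichotomy t qh.conjExponent with ht | ht | ht
  · simp only [ht, ht.le, true_or, if_true]
  · simp only [ht, le_refl, lt_irrefl, true_or, if_true, if_false]
  · simp only [ht.not_gt, ht.ne', ht.not_ge, false_or, if_false]
    by_cases hα : b₀ + b₁ ≤ α
    · simp only [hα, if_true, ht.not_gt, ht.ne', if_false, ite_self]
    · rcases le_or_gt t q.conjExponent with htq | htq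
      · simp only [hα, htq, min_eq_left, lt_irrefl, if_true, if_false]
      · simp only [hα, htq.not_ge, min_eq_right htq.le, htq.not_gt, htq.ne', if_false]

theorem conjExponent_le_conjExponent {r s : ℝ} (hr : 1 < r) (hrs : r ≤ s) :
    s.conjExponent ≤ r.conjExponent := by
  rw [Real.conjExponent, Real.conjExponent, div_le_div_iff₀ (by linarith) (by linarith)]
  linarith

theorem exists_conjExponent_eq {x : ℝ} (hq : 1 < q) (hqh : 1 < qh)
    (hx : x ∈ Set.Icc qh.conjExponent q.conjExponent) :
    ∃ r ∈ Set.Icc q qh, r.conjExponent = x := by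
  have hq_conj : q.HolderConjugate q.conjExponent := .conjExponent hq
  have hqh_conj : qh.HolderConjugate qh.conjExponent := .conjExponent hqh
  have hx1 : 1 < x := hqh_conj.symm.lt.trans_le hx.1
  refine ⟨x.conjExponent, ⟨?_, ?_⟩, (Real.HolderConjugate.conjExponent hx1).symm.conjugate_eq.symm⟩
  · rw [hq_conj.symm.conjugate_eq]
    exact conjExponent_le_conjExponent hx1 hx.2
  · rw [hqh_conj.symm.conjugate_eq]
    exact conjExponent_le_conjExponent hqh_conj.symm.lt hx.1

theorem optimalConj_mem_Icc (hq : 1 < q) (hqh : q ≤ qh) :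
    optimalConj q qh α γ b₀ b₁ ∈ Set.Icc qh.conjExponent q.conjExponent := by
  have hle : qh.conjExponent ≤ q.conjExponent := conjExponent_le_conjExponent hq hqh
  unfold optimalConj
  split_ifs with h
  · exact ⟨le_rfl, hle⟩
  · exact ⟨le_min (le_of_not_ge fun ht => h (.inl ht)) hle, min_le_right _ _⟩

theorem monotone_add_sub_mul_div {g h : ℝ} (hα : 0 < α) (hh : h ≤ α) :
    Monotone fun x => x + (g - h * x) / α := by
  intro x y hxy
  have hdiff : y + (g - h * y) / α - (x + (g - h * x) / α) = (y - x) * (α - h) / α := by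
    field_simp
    ring
  rw [← sub_nonneg, hdiff]
  exact div_nonneg (mul_nonneg (sub_nonneg.2 hxy) (sub_nonneg.2 hh)) hα.le

theorem strictAnti_add_sub_mul_div {g h : ℝ} (hα : 0 < α) (hh : α < h) :
    StrictAnti fun x => x + (g - h * x) / α := by
  intro x y hxy
  have hdiff : x + (g - h * x) / α - (y + (g - h * y) / α) = (y - x) * (h - α) / α := by
    field_simp
    ring
  rw [← sub_pos, hdiff]
  exact div_pos (mul_pos (sub_pos.2 hxy) (sub_pos.2 hh)) hα

theorem samplingOrder_min_lt {g h x z : ℝ} (hα : 0 < α) (hh : α < h) (hxz : x ≤ z)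
    (hne : min (g / h) z ≠ x) :
    samplingOrder α (min (g / h) z) (g - h * min (g / h) z) < samplingOrder α x (g - h * x) := by
  have hh0 : 0 < h := hα.trans hh
  have hnonneg : 0 ≤ g - h * min (g / h) z := by
    rw [sub_nonneg, ← le_div_iff₀' hh0]
    exact min_le_left _ _
  rw [samplingOrder_of_nonneg hα hnonneg]
  rcases hne.lt_or_gt with hlt | hgt
  · have hmin : min (g / h) z = g / h :=
      min_eq_left (le_of_not_ge fun hz => (hlt.trans_le hxz).ne (min_eq_right hz))
    rw [hmin, mul_div_cancel₀ g hh0.ne', sub_self, zero_div, add_zero, ← hmin]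
    exact hlt.trans_le (le_max_left _ _)
  · exact (strictAnti_add_sub_mul_div hα hh hgt).trans_le (le_max_right _ _)

theorem samplingOrder_optimalConj_le (hα : 0 < α) (hb : 0 < b₀ + b₁) {x : ℝ}
    (hx : x ∈ Set.Icc qh.conjExponent q.conjExponent) (hne : optimalConj q qh α γ b₀ b₁ ≠ x) :
    let κ := fun y => γ + b₁ - (b₀ + b₁) * y
    let x₀ := optimalConj q qh α γ b₀ b₁
    samplingOrder α x₀ (κ x₀) < samplingOrder α x (κ x) ∨
      κ x₀ ≠ 0 ∧ samplingOrder α x₀ (κ x₀) ≤ samplingOrder α x (κ x) := by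
  intro κ x₀
  rcases le_or_gt ((γ + b₁) / (b₀ + b₁)) qh.conjExponent with ht | ht
  · have hx₀ : x₀ = qh.conjExponent := if_pos (.inl ht)
    have hκ₀ : κ x₀ ≤ 0 := by rwa [sub_nonpos, ← div_le_iff₀' hb, hx₀]
    left
    rw [samplingOrder_of_nonpos hα hκ₀]
    exact ((hx₀ ▸ hx.1 : x₀ ≤ x).lt_of_ne hne).trans_le (le_max_left _ _)
  rcases le_or_gt (b₀ + b₁) α with hbα | hbα
  · have hx₀ : x₀ = qh.conjExponent := if_pos (.inr hbα)
    have hκ₀ : 0 < κ x₀ := by rwa [sub_pos, ← lt_div_iff₀' hb, hx₀]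
    refine .inr ⟨hκ₀.ne', ?_⟩
    rw [samplingOrder_of_nonneg hα hκ₀.le]
    exact (monotone_add_sub_mul_div hα hbα (hx₀ ▸ hx.1)).trans (le_max_right _ _)
  · have hx₀ : x₀ = min ((γ + b₁) / (b₀ + b₁)) q.conjExponent :=
      if_neg (not_or.2 ⟨ht.not_ge, hbα.not_ge⟩)
    left
    rw [hx₀]
    exact samplingOrder_min_lt hα hbα hx.2 (hx₀ ▸ hne)

theorem exists_optimalCostBound_eq_costBound (hq : 1 < q) (hqh : q ≤ qh) (hb : 0 < b₀ + b₁)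
    (hβ : ∀ r ∈ Set.Icc q qh, β r = b₀ + b₁ / r) :
    ∃ r ∈ Set.Icc q qh, ∀ ε, optimalCostBound q qh α γ b₀ b₁ A ε = costBound α γ β A r ε := by
  obtain ⟨r, hr, hrx⟩ := exists_conjExponent_eq hq (hq.trans_le hqh)
    (optimalConj_mem_Icc (α := α) (γ := γ) (b₀ := b₀) (b₁ := b₁) hq hqh)
  have hr1 : 1 < r := hq.trans_le hr.1
  refine ⟨r, hr, fun ε => ?_⟩
  rw [optimalCostBound_eq_add_samplingBound hb, costBound_eq_add_samplingBound hr1, hβ r hr,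
    sub_rate_mul_conjExponent hr1, hrx]

theorem exists_optimalCostBound_le_costBound (hq : 1 < q) (hqh : q ≤ qh) (hα : 0 < α)
    (hA : 1 < A) (hb : 0 < b₀ + b₁) {r : ℝ} (hr : r ∈ Set.Icc q qh) (hβ : β r = b₀ + b₁ / r) :
    ∃ C : ℝ, 0 < C ∧ ∀ ε ∈ Set.Ioc (0 : ℝ) (1 / 2),
      optimalCostBound q qh α γ b₀ b₁ A ε ≤ C * costBound α γ β A r ε := by
  have hr1 : 1 < r := hq.trans_le hr.1
  set x := r.conjExponent
  set x₀ := optimalConj q qh α γ b₀ b₁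
  have hx : x ∈ Set.Icc qh.conjExponent q.conjExponent :=
    ⟨conjExponent_le_conjExponent hr1 hr.2, conjExponent_le_conjExponent hq hr.1⟩
  have hqh_pos : 0 < qh.conjExponent :=
    (Real.HolderConjugate.conjExponent (hq.trans_le hqh)).symm.pos
  obtain ⟨C, _, hle⟩ : ∃ C : ℝ, 0 < C ∧ ∀ ε ∈ Set.Ioc (0 : ℝ) (1 / 2),
      samplingBound α A x₀ (γ + b₁ - (b₀ + b₁) * x₀) ε ≤
        C * samplingBound α A x (γ + b₁ - (b₀ + b₁) * x) ε := by
    by_cases hne : x₀ = x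
    · exact ⟨1, one_pos, fun ε _ => by rw [hne, one_mul]⟩
    · exact exists_samplingBound_le_samplingBound hα hA
        (hqh_pos.trans_le (optimalConj_mem_Icc hq hqh).1) (hqh_pos.trans_le hx.1)
        (samplingOrder_optimalConj_le hα hb hx hne)
  refine ⟨max 1 C, by positivity, fun ε hε => ?_⟩
  rw [optimalCostBound_eq_add_samplingBound hb, costBound_eq_add_samplingBound hr1, hβ,
    sub_rate_mul_conjExponent hr1, mul_add]
  exact add_le_add
    (le_mul_of_one_le_left (Real.rpow_nonneg hε.1.le _) (le_max_left _ _))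
    ((hle ε hε).trans (mul_le_mul_of_nonneg_right (le_max_right _ _) (samplingBound_nonneg hε.1)))

end OptimalExponent

section LevelSum

/-- The geometric sum `∑_{ℓ=1}^L A^(aℓ)`. -/
noncomputable def levelSum (A a : ℝ) (L : ℕ) : ℝ := ∑ ℓ ∈ Finset.Icc 1 L, (A ^ a) ^ ℓ

variable {α A K a x κ : ℝ}

theorem levelSum_nonneg (hA : 0 ≤ A) (L : ℕ) : 0 ≤ levelSum A a L :=
  Finset.sum_nonneg fun ℓ _ => by positivity

theorem levelSum_zero (L : ℕ) : levelSum A 0 L = L := by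
  simp [levelSum]

theorem exists_levelSum_le (hA : 1 < A) (ha : a < 0) :
    ∃ C : ℝ, 0 < C ∧ ∀ L, levelSum A a L ≤ C := by
  have hA0 : 0 < A := one_pos.trans hA
  have hlt : A ^ a < 1 := Real.rpow_lt_one_of_one_lt_of_neg hA ha
  exact ⟨(A ^ a) ^ 1 / (1 - A ^ a), div_pos (by positivity) (sub_pos.2 hlt),
    fun L => geom_sum_Ico_le_of_lt_one (by positivity) hlt⟩

theorem exists_levelSum_le_rpow (hA : 1 < A) (hK : 0 < K) (ha : 0 < a) :
    ∃ C : ℝ, 0 < C ∧ ∀ ε : ℝ, 0 < ε → ∀ L : ℕ, A ^ L ≤ K * ε ^ (-(1 / α)) →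
      levelSum A a L ≤ C * ε ^ (-(a / α)) := by
  have hA0 : 0 < A := one_pos.trans hA
  have hgt : 0 < A ^ a - 1 := sub_pos.2 (Real.one_lt_rpow hA ha)
  refine ⟨A ^ a / (A ^ a - 1) * K ^ a, by positivity, fun ε hε L hL => ?_⟩
  calc levelSum A a L = ((A ^ a) ^ (L + 1) - (A ^ a) ^ 1) / (A ^ a - 1) :=
        geom_sum_Ico (sub_ne_zero.1 hgt.ne') (by lia)
    _ ≤ A ^ a / (A ^ a - 1) * (A ^ L) ^ a := by
        rw [← Real.rpow_pow_comm hA0.le, div_mul_eq_mul_div, ← pow_succ']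
        gcongr
        exact sub_le_self _ (by positivity)
    _ ≤ A ^ a / (A ^ a - 1) * (K * ε ^ (-(1 / α))) ^ a := by gcongr
    _ = A ^ a / (A ^ a - 1) * K ^ a * ε ^ (-(a / α)) := by
        rw [Real.mul_rpow hK.le (by positivity), ← Real.rpow_mul hε.le, mul_assoc]
        ring_nf

theorem exists_level_le_abs_logb (hα : 0 < α) (hA : 1 < A) (hK : 0 < K) :
    ∃ C : ℝ, 0 < C ∧ ∀ ε ∈ Set.Ioc (0 : ℝ) (1 / 2), ∀ L : ℕ, A ^ L ≤ K * ε ^ (-(1 / α)) →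
      (L : ℝ) ≤ C * |Real.logb A ε| := by
  have hlog : 0 < Real.logb A 2 := Real.logb_pos hA one_lt_two
  refine ⟨|Real.logb A K| / Real.logb A 2 + 1 / α, by positivity, fun ε hε L hL => ?_⟩
  have hL_log : (L : ℝ) ≤ Real.logb A K + -(1 / α) * Real.logb A ε := by
    rw [← Real.logb_rpow_eq_mul_logb_of_pos hε.1,
      ← Real.logb_mul hK.ne' (Real.rpow_pos_of_pos hε.1 _).ne']
    calc (L : ℝ) = Real.logb A (A ^ L) := by
          rw [Real.logb_pow, Real.logb_self_eq_one hA, mul_one]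
      _ ≤ Real.logb A (K * ε ^ (-(1 / α))) := Real.logb_le_logb_of_le hA (by positivity) hL
  have hconst : Real.logb A K ≤ |Real.logb A K| / Real.logb A 2 * |Real.logb A ε| := by
    rw [div_mul_eq_mul_div, le_div_iff₀ hlog]
    exact mul_le_mul (le_abs_self _) (logb_two_le_abs_logb hA hε) hlog.le (abs_nonneg _)
  have hmain : -(1 / α) * Real.logb A ε ≤ 1 / α * |Real.logb A ε| := by
    rw [neg_mul, ← mul_neg]
    exact mul_le_mul_of_nonneg_left (neg_le_abs _) (by positivity)
  linarith

theorem exists_levelSum_mul_le_of_neg (hA : 1 < A) (hx : 0 < x) (hκ : κ < 0) :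
    ∃ C : ℝ, 0 < C ∧ ∀ ε : ℝ, 0 < ε → ∀ L : ℕ,
      ε ^ (-x) * (levelSum A (κ / (2 * x)) L ^ x * levelSum A (κ / 2) L)
        ≤ C * samplingBound α A x κ ε := by
  obtain ⟨C₁, hC₁, hW⟩ := exists_levelSum_le hA (div_neg_of_neg_of_pos hκ (mul_pos two_pos hx))
  obtain ⟨C₂, hC₂, hV⟩ := exists_levelSum_le hA (div_neg_of_neg_of_pos hκ two_pos)
  refine ⟨C₁ ^ x * C₂, by positivity, fun ε hε L => ?_⟩
  have hnonneg (a : ℝ) := levelSum_nonneg (a := a) (one_pos.trans hA).le L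
  rw [samplingBound, if_pos hκ, mul_comm]
  have := hnonneg (κ / (2 * x))
  have := hnonneg (κ / 2)
  gcongr
  · exact hW L
  · exact hV L

theorem exists_levelSum_mul_le_of_zero (hα : 0 < α) (hA : 1 < A) (hK : 0 < K) (hx : 0 < x) :
    ∃ C : ℝ, 0 < C ∧ ∀ ε ∈ Set.Ioc (0 : ℝ) (1 / 2), ∀ L : ℕ, A ^ L ≤ K * ε ^ (-(1 / α)) →
      ε ^ (-x) * (levelSum A 0 L ^ x * levelSum A 0 L) ≤ C * samplingBound α A x 0 ε := by
  obtain ⟨C, hC, hL_le⟩ := exists_level_le_abs_logb hα hA hK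
  refine ⟨C ^ (x + 1), by positivity, fun ε hε L hL => ?_⟩
  have hε0 := hε.1
  rw [samplingBound_zero, levelSum_zero, mul_left_comm (C ^ (x + 1)),
    ← Real.mul_rpow hC.le (abs_nonneg _)]
  gcongr
  calc (L : ℝ) ^ x * L = (L : ℝ) ^ (x + 1) := by
        rw [Real.rpow_add_of_nonneg L.cast_nonneg hx.le zero_le_one, Real.rpow_one]
    _ ≤ (C * |Real.logb A ε|) ^ (x + 1) :=
        Real.rpow_le_rpow L.cast_nonneg (hL_le ε hε L hL) (by linarith)

theorem exists_levelSum_mul_le_of_pos (hA : 1 < A) (hK : 0 < K) (hx : 0 < x) (hκ : 0 < κ) :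
    ∃ C : ℝ, 0 < C ∧ ∀ ε : ℝ, 0 < ε → ∀ L : ℕ, A ^ L ≤ K * ε ^ (-(1 / α)) →
      ε ^ (-x) * (levelSum A (κ / (2 * x)) L ^ x * levelSum A (κ / 2) L)
        ≤ C * samplingBound α A x κ ε := by
  obtain ⟨C₁, hC₁, hW⟩ :=
    exists_levelSum_le_rpow (α := α) hA hK (by positivity : 0 < κ / (2 * x))
  obtain ⟨C₂, hC₂, hV⟩ := exists_levelSum_le_rpow (α := α) hA hK (half_pos hκ)
  refine ⟨C₁ ^ x * C₂, by positivity, fun ε hε L hL => ?_⟩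
  have hnonneg (a : ℝ) := levelSum_nonneg (a := a) (one_pos.trans hA).le L
  rw [samplingBound, if_neg hκ.not_gt, if_neg hκ.ne']
  calc ε ^ (-x) * (levelSum A (κ / (2 * x)) L ^ x * levelSum A (κ / 2) L)
      ≤ ε ^ (-x) * ((C₁ * ε ^ (-(κ / (2 * x) / α))) ^ x * (C₂ * ε ^ (-(κ / 2 / α)))) := by
        have := hnonneg (κ / (2 * x))
        have := hnonneg (κ / 2)
        gcongr
        · exact hW ε hε L hL
        · exact hV ε hε L hL
    _ = C₁ ^ x * C₂ * (ε ^ (-x) * (ε ^ (-(κ / (2 * x) / α) * x) * ε ^ (-(κ / 2 / α)))) := by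
        rw [Real.mul_rpow hC₁.le (by positivity), ← Real.rpow_mul hε.le]
        ring
    _ = C₁ ^ x * C₂ * ε ^ (-x - κ / α) := by
        rw [← Real.rpow_add hε, ← Real.rpow_add hε]
        congr 2
        field_simp
        ring

theorem exists_levelSum_mul_le_samplingBound (hα : 0 < α) (hA : 1 < A) (hK : 0 < K) (hx : 0 < x) :
    ∃ C : ℝ, 0 < C ∧ ∀ ε ∈ Set.Ioc (0 : ℝ) (1 / 2), ∀ L : ℕ, A ^ L ≤ K * ε ^ (-(1 / α)) →
      ε ^ (-x) * (levelSum A (κ / (2 * x)) L ^ x * levelSum A (κ / 2) L)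
        ≤ C * samplingBound α A x κ ε := by
  rcases lt_trichotomy κ 0 with hκ | rfl | hκ
  · obtain ⟨C, hC, hle⟩ := exists_levelSum_mul_le_of_neg (α := α) hA hx hκ
    exact ⟨C, hC, fun ε hε L _ => hle ε hε.1 L⟩
  · simpa only [zero_div] using exists_levelSum_mul_le_of_zero hα hA hK hx
  · obtain ⟨C, hC, hle⟩ := exists_levelSum_mul_le_of_pos (α := α) hA hK hx hκ
    exact ⟨C, hC, fun ε hε L hL => hle ε hε.1 L hL⟩

end LevelSum

section SampleCounts

theorem exists_level {α A D : ℝ} (hα : 0 < α) (hA : 1 < A) (hD : 0 < D) :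
    ∃ K : ℝ, 0 < K ∧ ∀ ε ∈ Set.Ioc (0 : ℝ) 1, ∃ L : ℕ, 1 ≤ L ∧
      D * (A ^ (-α)) ^ L ≤ ε ∧ A ^ L ≤ K * ε ^ (-(1 / α)) := by
  have hA0 : 0 < A := one_pos.trans hA
  set K := max 1 (D ^ (1 / α))
  refine ⟨A * K, by positivity, fun ε hε => ?_⟩
  have hε0 : 0 < ε := hε.1
  have hone : 1 ≤ K * ε ^ (-(1 / α)) := one_le_mul_of_one_le_of_one_le (le_max_left _ _)
    (Real.one_le_rpow_of_pos_of_le_one_of_nonpos hε0 hε.2 (neg_nonpos.2 (by positivity)))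
  obtain ⟨n, hn, hn'⟩ := exists_nat_pow_near hone hA
  have hroot : (D / ε) ^ (1 / α) ≤ A ^ (n + 1) := by
    rw [Real.div_rpow hD.le hε0.le, div_eq_mul_inv, ← Real.rpow_neg hε0.le]
    exact (mul_le_mul_of_nonneg_right (le_max_right _ _) (by positivity)).trans hn'.le
  refine ⟨n + 1, n.succ_pos, ?_, ?_⟩
  · have hpow : D / ε ≤ (A ^ (n + 1)) ^ α := by
      rwa [one_div, Real.rpow_inv_le_iff_of_pos (by positivity) (by positivity) hα] at hroot
    rw [Real.rpow_pow_comm hA0.le, Real.rpow_neg (by positivity), ← div_eq_mul_inv,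
      div_le_iff₀ (by positivity), ← div_le_iff₀' hε0]
    exact hpow
  · rw [pow_succ', mul_assoc]
    gcongr

theorem rpow_inv_sub_one_le_inv {r x y m : ℝ} (hrx : r.HolderConjugate x) (hy : 0 < y)
    (hm : y ^ x ≤ m) : m ^ (r⁻¹ - 1) ≤ y⁻¹ := by
  have hexp : r⁻¹ - 1 = -x⁻¹ := by linarith [hrx.inv_add_inv_eq_one]
  calc m ^ (r⁻¹ - 1) ≤ (y ^ x) ^ (-x⁻¹) := by
        rw [hexp]
        exact Real.rpow_le_rpow_of_nonpos (by positivity) hm (neg_nonpos.2 hrx.symm.inv_nonneg)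
    _ = y⁻¹ := by
        rw [← Real.rpow_mul hy.le, mul_neg, mul_inv_cancel₀ hrx.symm.ne_zero, Real.rpow_neg_one]

theorem exists_sampleCount {ι : Type*} (I : Finset ι) {r x η : ℝ} (hrx : r.HolderConjugate x)
    (hη : 0 < η) {e w : ι → ℝ} (he : ∀ i ∈ I, 0 < e i) (hw : ∀ i ∈ I, 0 < w i) :
    ∃ M : ι → ℕ, (∀ i, 1 ≤ M i) ∧ ∑ i ∈ I, e i * (M i : ℝ) ^ (r⁻¹ - 1) ≤ η ∧
      ∀ i ∈ I, (M i : ℝ) ≤ (e i * (∑ j ∈ I, w j) / (η * w i)) ^ x + 1 := by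
  set W := ∑ j ∈ I, w j
  set y : ι → ℝ := fun i => e i * W / (η * w i)
  have hy : ∀ i ∈ I, 0 < y i := fun i hi => div_pos
    (mul_pos (he i hi) (Finset.sum_pos hw ⟨i, hi⟩)) (mul_pos hη (hw i hi))
  refine ⟨fun i => ⌊y i ^ x⌋₊ + 1, fun i => Nat.succ_pos _, ?_, fun i hi => ?_⟩
  · calc ∑ i ∈ I, e i * ((⌊y i ^ x⌋₊ + 1 : ℕ) : ℝ) ^ (r⁻¹ - 1) ≤ ∑ i ∈ I, η * w i / W := by
          refine Finset.sum_le_sum fun i hi => ?_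
          have hM : y i ^ x ≤ ((⌊y i ^ x⌋₊ + 1 : ℕ) : ℝ) := by
            exact_mod_cast (Nat.lt_floor_add_one _).le
          refine (mul_le_mul_of_nonneg_left (rpow_inv_sub_one_le_inv hrx (hy i hi) hM)
            (he i hi).le).trans_eq ?_
          rw [inv_div, mul_div_assoc', mul_div_mul_left _ _ (he i hi).ne']
      _ = η * (W / W) := by rw [← Finset.sum_div, ← Finset.mul_sum, mul_div_assoc]
      _ ≤ η := mul_le_of_le_one_right hη.le (div_self_le_one W)
  · push_cast
    gcongr
    exact Nat.floor_le (Real.rpow_nonneg (hy i hi).le x)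

theorem exists_geometric_sampleCount {A D b γ η r x : ℝ} (hA : 0 < A) (hD : 0 < D) (hη : 0 < η)
    (hrx : r.HolderConjugate x) (L : ℕ) :
    ∃ M : ℕ → ℕ, (∀ ℓ, 1 ≤ M ℓ) ∧
      ∑ ℓ ∈ Finset.Icc 1 L, D * (A ^ (-b)) ^ ℓ * (M ℓ : ℝ) ^ (r⁻¹ - 1) ≤ η ∧
      ∑ ℓ ∈ Finset.Icc 1 L, M ℓ * (A ^ γ) ^ ℓ ≤ (D / η) ^ x *
        (levelSum A ((γ - b * x) / (2 * x)) L ^ x * levelSum A ((γ - b * x) / 2) L) +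
        levelSum A γ L := by
  set κ := γ - b * x with hκ
  set W := levelSum A (κ / (2 * x)) L
  have hx : 0 < x := hrx.symm.pos
  have hW : 0 ≤ W := levelSum_nonneg hA.le L
  obtain ⟨M, hM, herror, hM_le⟩ := exists_sampleCount (Finset.Icc 1 L) hrx hη
    (e := fun ℓ => D * (A ^ (-b)) ^ ℓ) (w := fun ℓ => (A ^ (κ / (2 * x))) ^ ℓ)
    (fun ℓ _ => by positivity) fun ℓ _ => by positivity
  have hbalance (ℓ : ℕ) :
      (D * (A ^ (-b)) ^ ℓ * W / (η * (A ^ (κ / (2 * x))) ^ ℓ)) ^ x * (A ^ γ) ^ ℓ =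
        (D / η) ^ x * (W ^ x * (A ^ (κ / 2)) ^ ℓ) := by
    have hsplit : D * (A ^ (-b)) ^ ℓ * W / (η * (A ^ (κ / (2 * x))) ^ ℓ) =
        D / η * W * (A ^ (-b - κ / (2 * x))) ^ ℓ := by
      rw [Real.rpow_sub hA, div_pow]
      field_simp
    have hexponent : (-b - κ / (2 * x)) * x + γ = κ / 2 := by
      rw [hκ]
      field_simp
      ring
    rw [hsplit, Real.mul_rpow (by positivity) (by positivity), Real.mul_rpow (by positivity) hW,
      ← Real.rpow_pow_comm (by positivity), ← Real.rpow_mul hA.le, mul_assoc, mul_assoc, ← mul_pow,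
      ← Real.rpow_add hA, hexponent]
  refine ⟨M, hM, herror, ?_⟩
  calc ∑ ℓ ∈ Finset.Icc 1 L, M ℓ * (A ^ γ) ^ ℓ
      ≤ ∑ ℓ ∈ Finset.Icc 1 L,
          ((D / η) ^ x * (W ^ x * (A ^ (κ / 2)) ^ ℓ) + (A ^ γ) ^ ℓ) := by
        refine Finset.sum_le_sum fun ℓ hℓ => ?_
        rw [← hbalance, ← add_one_mul]
        exact mul_le_mul_of_nonneg_right (hM_le ℓ hℓ) (by positivity)
    _ = (D / η) ^ x * (W ^ x * levelSum A (κ / 2) L) + levelSum A γ L := by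
        rw [Finset.sum_add_distrib, ← Finset.mul_sum, ← Finset.mul_sum]
        rfl

theorem exists_levels_and_samples {r x α γ b A D E : ℝ} (hrx : r.HolderConjugate x) (hα : 0 < α)
    (hγ : 0 < γ) (hA : 1 < A) (hD : 0 < D) (hE : 0 < E) :
    ∃ C : ℝ, 0 < C ∧ ∀ ε ∈ Set.Ioc (0 : ℝ) (1 / 2), ∃ (L : ℕ) (M : ℕ → ℕ),
      1 ≤ L ∧ (∀ ℓ, 1 ≤ M ℓ) ∧
      D * (A ^ (-α)) ^ L +
        ∑ ℓ ∈ Finset.Icc 1 L, E * (A ^ (-b)) ^ ℓ * (M ℓ : ℝ) ^ (r⁻¹ - 1) < ε ∧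
      ∑ ℓ ∈ Finset.Icc 1 L, M ℓ * (A ^ γ) ^ ℓ
        ≤ C * (ε ^ (-(γ / α)) + samplingBound α A x (γ - b * x) ε) := by
  obtain ⟨K, hK, hlevel⟩ := exists_level hα hA (mul_pos three_pos hD)
  obtain ⟨C₁, hC₁, hsampling⟩ :=
    exists_levelSum_mul_le_samplingBound (κ := γ - b * x) hα hA hK hrx.symm.pos
  obtain ⟨C₂, hC₂, hcoarse⟩ := exists_levelSum_le_rpow (α := α) hA hK hγ
  refine ⟨max C₂ ((3 * E) ^ x * C₁), by positivity, fun ε hε => ?_⟩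
  have hε0 : 0 < ε := hε.1
  obtain ⟨L, hL, hbias, hL_le⟩ := hlevel ε ⟨hε0, hε.2.trans (by norm_num)⟩
  obtain ⟨M, hM, herror, hcost⟩ :=
    exists_geometric_sampleCount (b := b) (γ := γ) (one_pos.trans hA) hE
      (div_pos hε0 three_pos) hrx L
  refine ⟨L, M, hL, hM, by linarith, hcost.trans ?_⟩
  have hbudget : (E / (ε / 3)) ^ x = (3 * E) ^ x * ε ^ (-x) := by
    rw [Real.rpow_neg hε0.le, ← div_eq_mul_inv, ← Real.div_rpow (by positivity) hε0.le,
      div_div_eq_mul_div, mul_comm E]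
  rw [hbudget, mul_assoc, add_comm, mul_add]
  refine add_le_add ?_ ?_
  · refine (hcoarse ε hε0 L hL_le).trans ?_
    gcongr
    exact le_max_left _ _
  · refine (mul_le_mul_of_nonneg_left (hsampling ε hε L hL_le) (by positivity)).trans ?_
    rw [← mul_assoc]
    exact mul_le_mul_of_nonneg_right (le_max_right _ _) (samplingBound_nonneg hε0)

end SampleCounts

section Error

variable {S : Type*} [MeasurableSpace S] {μ : Measure S} {Ω : Type*} [MeasurableSpace Ω]
  {P : Measure Ω} {p : ℝ≥0∞} [Fact (1 ≤ p)] {Xlim : Ω → Lp ℝ p μ} {X : ℕ → Ω → Lp ℝ p μ}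
  {ξ : ℕ → ℕ → Ω → Lp ℝ p μ}

theorem integral_increment (hX : ∀ ℓ, Integrable (X ℓ) P) (ℓ : ℕ) :
    ∫ ω, increment X ℓ ω ∂P = (∫ ω, X ℓ ω ∂P) - ∫ ω, X (ℓ - 1) ω ∂P :=
  integral_sub (hX ℓ) (hX (ℓ - 1))

theorem sum_integral_increment (hX0 : ∀ ω, X 0 ω = 0) (hX : ∀ ℓ, Integrable (X ℓ) P) (L : ℕ) :
    ∑ ℓ ∈ Finset.Icc 1 L, ∫ ω, increment X ℓ ω ∂P = ∫ ω, X L ω ∂P := by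
  induction L with
  | zero => simp [hX0]
  | succ L ih =>
    rw [Finset.sum_Icc_succ_top (by lia), ih, integral_increment hX, add_tsub_cancel_right,
      add_sub_cancel]

theorem mlmcError_le_bias_add_sum [IsProbabilityMeasure P] {q : ℝ} (hq : 1 ≤ q) {L : ℕ}
    (hX0 : ∀ ω, X 0 ω = 0) (hX : ∀ ℓ, Integrable (X ℓ) P)
    (hξ : ∀ ℓ ∈ Finset.Icc 1 L, ∀ j, AEStronglyMeasurable (ξ ℓ j) P) (M : ℕ → ℕ) :
    mlmcError P q Xlim ξ L M ≤ ‖(∫ ω, Xlim ω ∂P) - ∫ ω, X L ω ∂P‖ₑ + ∑ ℓ ∈ Finset.Icc 1 L,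
      eLpNorm (fun ω => (∫ ω', increment X ℓ ω' ∂P) -
        (M ℓ : ℝ)⁻¹ • ∑ j ∈ Finset.range (M ℓ), ξ ℓ j ω) (ENNReal.ofReal q) P := by
  have hq1 : 1 ≤ ENNReal.ofReal q := ENNReal.one_le_ofReal.2 hq
  set samplingError : ℕ → Ω → Lp ℝ p μ := fun ℓ ω => (∫ ω', increment X ℓ ω' ∂P) -
    (M ℓ : ℝ)⁻¹ • ∑ j ∈ Finset.range (M ℓ), ξ ℓ j ω with hsamplingError
  have hdecomp : (fun ω => (∫ ω', Xlim ω' ∂P) - estimator ξ L M ω) =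
      (fun _ => (∫ ω', Xlim ω' ∂P) - ∫ ω', X L ω' ∂P) +
        ∑ ℓ ∈ Finset.Icc 1 L, samplingError ℓ := by
    funext ω
    simp only [Pi.add_apply, Finset.sum_apply, hsamplingError, Finset.sum_sub_distrib,
      sum_integral_increment hX0 hX, estimator, sub_add_sub_cancel]
  have hmeas : ∀ ℓ ∈ Finset.Icc 1 L, AEStronglyMeasurable (samplingError ℓ) P := fun ℓ hℓ =>
    aestronglyMeasurable_const.sub
      ((Finset.aestronglyMeasurable_fun_sum _ fun j _ => hξ ℓ hℓ j).fun_const_smul _)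
  rw [mlmcError, hdecomp]
  refine (eLpNorm_add_le aestronglyMeasurable_const
    (Finset.aestronglyMeasurable_sum _ hmeas) hq1).trans
      (add_le_add ?_ (eLpNorm_sum_le hmeas hq1))
  rw [eLpNorm_const' _ (zero_lt_one.trans_le hq1).ne' ENNReal.ofReal_ne_top, measure_univ,
    ENNReal.one_rpow, mul_one]

end Error

section FixedExponent

/-- The part of the multilevel hypotheses that refers to one integrability exponent `r`: the bias,
strong error and cost decay at the rates `N ℓ ^ (-α)`, `N ℓ ^ (-b)` and `N ℓ ^ γ`, the strong error
being that of the centred increments in `L^p(S; L^r(Ω))`. -/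
structure FixedExponentSetting {S : Type u} [MeasurableSpace S] (μ : Measure S) {Ω : Type v}
    [MeasurableSpace Ω] (P : Measure Ω) {p : ℝ≥0∞} [Fact (1 ≤ p)]
    (r α γ b A Cα Cβ Cγ c₁ c₂ : ℝ) (Xlim : Ω → Lp ℝ p μ) (X : ℕ → Ω → Lp ℝ p μ)
    (ξ : ℕ → ℕ → Ω → Lp ℝ p μ) (N cost : ℕ → ℝ) : Prop where
  integrable_lim : Integrable Xlim P
  zero_level : ∀ ω, X 0 ω = 0
  integrable_level : ∀ ℓ, Integrable (X ℓ) P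
  N_equiv : ∀ ℓ, 1 ≤ ℓ → c₁ * A ^ ℓ ≤ N ℓ ∧ N ℓ ≤ c₂ * A ^ ℓ
  bias : ∀ ℓ, 1 ≤ ℓ → ‖(∫ ω, Xlim ω ∂P) - ∫ ω, X ℓ ω ∂P‖ ≤ Cα * N ℓ ^ (-α)
  strong : ∀ ℓ, 1 ≤ ℓ →
    mixedNorm P (ENNReal.ofReal r) (fun ω => increment X ℓ ω - ∫ ω', increment X ℓ ω' ∂P)
      ≤ ENNReal.ofReal (Cβ * N ℓ ^ (-b))
  cost_le : ∀ ℓ, 1 ≤ ℓ → cost ℓ ≤ Cγ * N ℓ ^ γ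
  indep : ∀ ℓ, 1 ≤ ℓ → iIndepFun (ξ ℓ) P
  copy : ∀ ℓ, 1 ≤ ℓ → ∀ j, IdentDistrib (ξ ℓ j) (increment X ℓ) P P

variable {S : Type u} [MeasurableSpace S] {μ : Measure S} {Ω : Type v} [MeasurableSpace Ω]
  {P : Measure Ω} {p : ℝ≥0∞} [Fact (1 ≤ p)] {q r α γ b A Cα Cβ Cγ c₁ c₂ : ℝ}
  {Xlim : Ω → Lp ℝ p μ} {X : ℕ → Ω → Lp ℝ p μ} {ξ : ℕ → ℕ → Ω → Lp ℝ p μ} {N cost : ℕ → ℝ}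

theorem Setting.fixedExponent [IsProbabilityMeasure P] {qt : ℝ} [Fact (1 ≤ ENNReal.ofReal qt)]
    {β : ℝ → ℝ} (H : Setting μ P q qt α γ β A Cα Cβ Cγ c₁ c₂ Xlim X ξ N cost)
    (hr : r ∈ Set.Icc q (min qt 2)) :
    FixedExponentSetting μ P r α γ (β r) A Cα Cβ Cγ c₁ c₂ Xlim X ξ N cost := by
  have hX : ∀ ℓ, Integrable (X ℓ) P := fun ℓ => by
    rcases Nat.eq_zero_or_pos ℓ with rfl | hℓ
    · rw [funext H.zero_level]
      exact integrable_zero _ _ _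
    · exact (H.memLp_level ℓ hℓ).integrable Fact.out
  refine ⟨memLp_one_iff_integrable.1 H.integrable_lim, H.zero_level, hX, H.N_equiv, H.bias,
    fun ℓ hℓ => ?_, H.cost_le, H.indep, H.copy⟩
  have hcentred : (fun ω => increment X ℓ ω - ∫ ω', increment X ℓ ω' ∂P) = fun ω =>
      X ℓ ω - (∫ ω', X ℓ ω' ∂P) - (X (ℓ - 1) ω - ∫ ω', X (ℓ - 1) ω' ∂P) := by
    funext ω
    rw [integral_increment hX, increment, sub_sub_sub_comm]
  rw [hcentred]
  exact H.strong r hr ℓ hℓ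

theorem rpow_le_max_rpow_mul {n y : ℝ} (hc₁ : 0 < c₁) (hy : 0 < y) (hn : c₁ * y ≤ n)
    (hn' : n ≤ c₂ * y) (s : ℝ) : n ^ s ≤ max (c₁ ^ s) (c₂ ^ s) * y ^ s := by
  have hn0 : 0 < n := (mul_pos hc₁ hy).trans_le hn
  have hc₂ : 0 < c₂ := pos_of_mul_pos_left (hn0.trans_le hn') hy.le
  rw [max_mul_of_nonneg _ _ (by positivity), ← Real.mul_rpow hc₁.le hy.le,
    ← Real.mul_rpow hc₂.le hy.le]
  rcases le_total 0 s with hs | hs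
  · exact (Real.rpow_le_rpow hn0.le hn' hs).trans (le_max_right _ _)
  · exact (Real.rpow_le_rpow_of_nonpos (mul_pos hc₁ hy) hn hs).trans (le_max_left _ _)

namespace FixedExponentSetting

theorem rpow_le (H : FixedExponentSetting μ P r α γ b A Cα Cβ Cγ c₁ c₂ Xlim X ξ N cost)
    (hA : 0 < A) (hc₁ : 0 < c₁) {ℓ : ℕ} (hℓ : 1 ≤ ℓ) (s : ℝ) :
    N ℓ ^ s ≤ max (c₁ ^ s) (c₂ ^ s) * (A ^ s) ^ ℓ := by
  rw [Real.rpow_pow_comm hA.le]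
  exact rpow_le_max_rpow_mul hc₁ (by positivity) (H.N_equiv ℓ hℓ).1 (H.N_equiv ℓ hℓ).2 s

theorem mlmcError_le [SigmaFinite μ] [IsProbabilityMeasure P]
    (H : FixedExponentSetting μ P r α γ b A Cα Cβ Cγ c₁ c₂ Xlim X ξ N cost) (hq : 1 ≤ q)
    (hp : p ≤ ENNReal.ofReal q) (hr : 1 < r) (hqr : q ≤ r) (hr2 : r ≤ 2) (hA : 0 < A)
    (hc₁ : 0 < c₁) (hCα : 0 ≤ Cα) (hCβ : 0 ≤ Cβ) {L : ℕ} (hL : 1 ≤ L) {M : ℕ → ℕ}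
    (hM : ∀ ℓ, 1 ≤ M ℓ) :
    mlmcError P q Xlim ξ L M ≤ ENNReal.ofReal
      (Cα * max (c₁ ^ (-α)) (c₂ ^ (-α)) * (A ^ (-α)) ^ L + ∑ ℓ ∈ Finset.Icc 1 L,
        4 * Cβ * max (c₁ ^ (-b)) (c₂ ^ (-b)) * (A ^ (-b)) ^ ℓ * (M ℓ : ℝ) ^ (r⁻¹ - 1)) := by
  have hmax (s : ℝ) : 0 < max (c₁ ^ s) (c₂ ^ s) := lt_max_of_lt_left (by positivity)
  have hα := hmax (-α)
  have hb := hmax (-b)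
  have hbias : ‖(∫ ω, Xlim ω ∂P) - ∫ ω, X L ω ∂P‖ₑ ≤
      ENNReal.ofReal (Cα * max (c₁ ^ (-α)) (c₂ ^ (-α)) * (A ^ (-α)) ^ L) := by
    rw [← ofReal_norm, mul_assoc]
    exact ENNReal.ofReal_le_ofReal ((H.bias L hL).trans
      (mul_le_mul_of_nonneg_left (H.rpow_le hA hc₁ hL (-α)) hCα))
  rw [ENNReal.ofReal_add (by positivity) (Finset.sum_nonneg fun ℓ _ => by positivity),
    ENNReal.ofReal_sum_of_nonneg fun ℓ _ => by positivity]
  refine (mlmcError_le_bias_add_sum hq H.zero_level H.integrable_level (fun ℓ hℓ j =>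
    (H.copy ℓ (Finset.mem_Icc.1 hℓ).1 j).aestronglyMeasurable_iff.2
      ((H.integrable_level ℓ).sub (H.integrable_level (ℓ - 1))).aestronglyMeasurable) M).trans
    (add_le_add hbias (Finset.sum_le_sum fun ℓ hℓ => ?_))
  have hℓ1 : 1 ≤ ℓ := (Finset.mem_Icc.1 hℓ).1
  have hsample := eLpNorm_integral_sub_mean_le hp hqr hr hr2
    ((H.integrable_level ℓ).sub (H.integrable_level (ℓ - 1))) (H.indep ℓ hℓ1) (H.copy ℓ hℓ1)
    (Finset.nonempty_range_iff.2 (Nat.one_le_iff_ne_zero.1 (hM ℓ)))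
  rw [Finset.card_range] at hsample
  refine hsample.trans ((mul_le_mul_right (H.strong ℓ hℓ1) _).trans ?_)
  rw [← ENNReal.ofReal_mul (by positivity)]
  refine ENNReal.ofReal_le_ofReal ?_
  calc 4 * (M ℓ : ℝ) ^ (r⁻¹ - 1) * (Cβ * N ℓ ^ (-b))
      ≤ 4 * (M ℓ : ℝ) ^ (r⁻¹ - 1) *
          (Cβ * (max (c₁ ^ (-b)) (c₂ ^ (-b)) * (A ^ (-b)) ^ ℓ)) := by
        gcongr
        exact H.rpow_le hA hc₁ hℓ1 (-b)
    _ = _ := by ring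

theorem mlmcCost_le (H : FixedExponentSetting μ P r α γ b A Cα Cβ Cγ c₁ c₂ Xlim X ξ N cost)
    (hA : 0 < A) (hc₁ : 0 < c₁) (hCγ : 0 ≤ Cγ) (L : ℕ) (M : ℕ → ℕ) :
    mlmcCost cost L M ≤
      Cγ * max (c₁ ^ γ) (c₂ ^ γ) * ∑ ℓ ∈ Finset.Icc 1 L, M ℓ * (A ^ γ) ^ ℓ := by
  rw [mlmcCost, Finset.mul_sum]
  refine Finset.sum_le_sum fun ℓ hℓ => ?_
  have hℓ1 : 1 ≤ ℓ := (Finset.mem_Icc.1 hℓ).1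
  calc (M ℓ : ℝ) * cost ℓ ≤ M ℓ * (Cγ * (max (c₁ ^ γ) (c₂ ^ γ) * (A ^ γ) ^ ℓ)) := by
        gcongr
        exact (H.cost_le ℓ hℓ1).trans
          (mul_le_mul_of_nonneg_left (H.rpow_le hA hc₁ hℓ1 γ) hCγ)
    _ = Cγ * max (c₁ ^ γ) (c₂ ^ γ) * (M ℓ * (A ^ γ) ^ ℓ) := by ring

end FixedExponentSetting

theorem exists_mlmcError_lt_mlmcCost_le (hr : 1 < r) (hr2 : r ≤ 2) (hα : 0 < α) (hγ : 0 < γ)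
    (hA : 1 < A) (hCα : 0 < Cα) (hCβ : 0 < Cβ) (hCγ : 0 < Cγ) (hc₁ : 0 < c₁) (c₂ : ℝ)
    (β : ℝ → ℝ) :
    ∃ C : ℝ, 0 < C ∧
      ∀ (S : Type u) [MeasurableSpace S] (μ : Measure S) [SigmaFinite μ]
        (Ω : Type v) [MeasurableSpace Ω] (P : Measure Ω) [IsProbabilityMeasure P]
        (p : ℝ≥0∞) [Fact (1 ≤ p)]
        (Xlim : Ω → Lp ℝ p μ) (X : ℕ → Ω → Lp ℝ p μ) (ξ : ℕ → ℕ → Ω → Lp ℝ p μ)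
        (N cost : ℕ → ℝ),
        FixedExponentSetting μ P r α γ (β r) A Cα Cβ Cγ c₁ c₂ Xlim X ξ N cost →
        ∀ q ∈ Set.Icc 1 r, p ≤ ENNReal.ofReal q →
        ∀ ε ∈ Set.Ioc (0 : ℝ) (1 / 2), ∃ (L : ℕ) (M : ℕ → ℕ),
          1 ≤ L ∧ (∀ ℓ ∈ Finset.Icc 1 L, 1 ≤ M ℓ) ∧
          mlmcError P q Xlim ξ L M < ENNReal.ofReal ε ∧
          mlmcCost cost L M ≤ C * costBound α γ β A r ε := by
  have hA0 : 0 < A := one_pos.trans hA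
  have hmax (s : ℝ) : 0 < max (c₁ ^ s) (c₂ ^ s) := lt_max_of_lt_left (by positivity)
  obtain ⟨C, hC, hlevels⟩ := exists_levels_and_samples (b := β r)
    (Real.HolderConjugate.conjExponent hr) hα hγ hA (mul_pos hCα (hmax (-α)))
    (mul_pos (mul_pos four_pos hCβ) (hmax (-β r)))
  have hCγ_max : 0 < Cγ * max (c₁ ^ γ) (c₂ ^ γ) := mul_pos hCγ (hmax γ)
  refine ⟨Cγ * max (c₁ ^ γ) (c₂ ^ γ) * C, mul_pos hCγ_max hC,
    fun S _ μ _ Ω _ P _ p _ Xlim X ξ N cost H q hq hp ε hε => ?_⟩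
  obtain ⟨L, M, hL, hM, herror, hcost⟩ := hlevels ε hε
  refine ⟨L, M, hL, fun ℓ _ => hM ℓ,
    (H.mlmcError_le hq.1 hp hr hq.2 hr2 hA0 hc₁ hCα.le hCβ.le hL hM).trans_lt
      ((ENNReal.ofReal_lt_ofReal_iff hε.1).2 herror),
    (H.mlmcCost_le hA0 hc₁ hCγ.le L M).trans ?_⟩
  rw [costBound_eq_add_samplingBound hr, mul_assoc _ C]
  exact mul_le_mul_of_nonneg_left hcost hCγ_max.le

end FixedExponent

end MLMC

theorem mainTheorem6_general
    (q qh : ℝ) (hq : 1 < q) (hqh : q ≤ qh) (hqh2 : qh ≤ 2)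
    (α γ Cα Cβ Cγ A c₁ c₂ : ℝ) (hα : 0 < α) (hγ : 0 < γ)
    (hCα : 0 < Cα) (hCβ : 0 < Cβ) (hCγ : 0 < Cγ) (hA : 1 < A) (hc₁ : 0 < c₁)
    (β : ℝ → ℝ) (b₀ b₁ : ℝ) (hb : 0 < b₀ + b₁) (hβ : ∀ r ∈ Set.Icc q qh, β r = b₀ + b₁ / r) :
    (∃ C : ℝ, 0 < C ∧
      ∀ (S : Type u) [MeasurableSpace S] (μ : Measure S) [SigmaFinite μ]
        (Ω : Type v) [MeasurableSpace Ω] (P : Measure Ω) [IsProbabilityMeasure P]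
        (p : ℝ≥0∞) [Fact (1 ≤ p)]
        (Xlim : Ω → Lp ℝ p μ) (X : ℕ → Ω → Lp ℝ p μ) (ξ : ℕ → ℕ → Ω → Lp ℝ p μ)
        (N cost : ℕ → ℝ),
        p ≤ ENNReal.ofReal q →
        (∀ r ∈ Set.Icc q qh,
          MLMC.FixedExponentSetting μ P r α γ (β r) A Cα Cβ Cγ c₁ c₂ Xlim X ξ N cost) →
        ∀ ε ∈ Set.Ioc (0 : ℝ) (1 / 2), ∃ (L : ℕ) (M : ℕ → ℕ),
          1 ≤ L ∧ (∀ ℓ ∈ Finset.Icc 1 L, 1 ≤ M ℓ) ∧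
          MLMC.mlmcError P q Xlim ξ L M < ENNReal.ofReal ε ∧
          MLMC.mlmcCost cost L M ≤ C * MLMC.optimalCostBound q qh α γ b₀ b₁ A ε) ∧
    (∃ r ∈ Set.Icc q qh, ∀ ε ∈ Set.Ioc (0 : ℝ) (1 / 2),
      MLMC.optimalCostBound q qh α γ b₀ b₁ A ε = MLMC.costBound α γ β A r ε) ∧
    (∀ r ∈ Set.Icc q qh, ∃ C : ℝ, 0 < C ∧ ∀ ε ∈ Set.Ioc (0 : ℝ) (1 / 2),
      MLMC.optimalCostBound q qh α γ b₀ b₁ A ε ≤ C * MLMC.costBound α γ β A r ε) := by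
  obtain ⟨r, hr, hopt⟩ := MLMC.exists_optimalCostBound_eq_costBound (α := α) (γ := γ) (A := A)
    hq hqh hb hβ
  refine ⟨?_, ⟨r, hr, fun ε _ => hopt ε⟩, fun s hs =>
    MLMC.exists_optimalCostBound_le_costBound hq hqh hα hA hb hs (hβ s hs)⟩
  obtain ⟨C, hC, hmlmc⟩ := MLMC.exists_mlmcError_lt_mlmcCost_le (hq.trans_le hr.1)
    (hr.2.trans hqh2) hα hγ hA hCα hCβ hCγ hc₁ c₂ β
  refine ⟨C, hC, fun S _ μ _ Ω _ P _ p _ Xlim X ξ N cost hp H ε hε => ?_⟩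
  rw [hopt]
  exact hmlmc S μ Ω P p Xlim X ξ N cost (H r hr) q ⟨hq.le, hr.1⟩ hp ε hε

theorem mainTheorem6
    (q qt : ℝ) (hq : q ∈ Set.Ioo (1 : ℝ) 2) (hqt : q ≤ qt) [Fact (1 ≤ ENNReal.ofReal qt)]
    (α γ Cα Cβ Cγ A c₁ c₂ : ℝ) (hα : 0 < α) (hγ : 0 < γ)
    (hCα : 0 < Cα) (hCβ : 0 < Cβ) (hCγ : 0 < Cγ) (hA : 1 < A) (hc₁ : 0 < c₁) (hc₂ : 0 < c₂)
    (β : ℝ → ℝ) (b₀ b₁ : ℝ) (hb₁ : 0 < b₁)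
    (hβ : ∀ r ∈ Set.Icc q (min qt 2), β r = b₀ + b₁ / r ∧ 0 < b₀ + b₁ / r) :
    -- the accuracy `ε` is achieved at the stated cost; the constant `C` depends only on the
    -- numerical parameters above
    (∃ C : ℝ, 0 < C ∧
      ∀ (S : Type u) [MeasurableSpace S] (μ : Measure S) [SigmaFinite μ]
        (Ω : Type v) [MeasurableSpace Ω] (P : Measure Ω) [IsProbabilityMeasure P]
        (p : ℝ≥0∞) [Fact (1 ≤ p)]
        (Xlim : Ω → Lp ℝ p μ) (X : ℕ → Ω → Lp ℝ p μ) (ξ : ℕ → ℕ → Ω → Lp ℝ p μ)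
        (N cost : ℕ → ℝ),
        MLMC.ApproximationByAveraging.{u, v} μ →
        p ≤ ENNReal.ofReal q →
        MLMC.Setting μ P q qt α γ β A Cα Cβ Cγ c₁ c₂ Xlim X ξ N cost →
        ∀ ε ∈ Set.Ioc (0 : ℝ) (1 / 2), ∃ (L : ℕ) (M : ℕ → ℕ),
          1 ≤ L ∧ (∀ ℓ ∈ Finset.Icc 1 L, 1 ≤ M ℓ) ∧
          MLMC.mlmcError P q Xlim ξ L M < ENNReal.ofReal ε ∧
          MLMC.mlmcCost cost L M ≤ C * MLMC.optimalCostBound q (min qt 2) α γ b₀ b₁ A ε) ∧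
    -- the bound is the optimal one among the bounds for the exponents `r ∈ [q, min qt 2]`
    (∃ r ∈ Set.Icc q (min qt 2), ∀ ε ∈ Set.Ioc (0 : ℝ) (1 / 2),
      MLMC.optimalCostBound q (min qt 2) α γ b₀ b₁ A ε = MLMC.costBound α γ β A r ε) ∧
    (∀ r ∈ Set.Icc q (min qt 2), ∃ C : ℝ, 0 < C ∧ ∀ ε ∈ Set.Ioc (0 : ℝ) (1 / 2),
      MLMC.optimalCostBound q (min qt 2) α γ b₀ b₁ A ε ≤ C * MLMC.costBound α γ β A r ε) := by
  have hb : 0 < b₀ + b₁ := (hβ q ⟨le_rfl, le_min hqt hq.2.le⟩).2.trans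
    (add_lt_add_right (div_lt_self hb₁ hq.1) b₀)
  obtain ⟨⟨C, hC, hmlmc⟩, hopt⟩ := mainTheorem6_general.{u, v} q (min qt 2) hq.1
    (le_min hqt hq.2.le) (min_le_right _ _) α γ Cα Cβ Cγ A c₁ c₂ hα hγ hCα hCβ hCγ hA hc₁ β b₀ b₁
    hb fun r hr => (hβ r hr).1
  exact ⟨⟨C, hC, fun S _ μ _ Ω _ P _ p _ Xlim X ξ N cost _ hp H =>
    hmlmc S μ Ω P p Xlim X ξ N cost hp fun r hr => H.fixedExponent hr⟩, hopt⟩
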